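/- Let $K$ be a field equipped with the trivial absolute value, and let $X$ be a regular projective curve over $\operatorname{Spec} K$ (an integral, regular, projective $K$-scheme of dimension $1$) such that $\dim_{\mathbb Q}(\operatorname{Pic}(X)\otimes\mathbb Q)=1$. Let $X^{\mathrm{an}}$ be the Berkovich space of $X$. An $\mathbb R$-Cartier divisor is an element of $\operatorname{Div}(X)\otimes\mathbb R$; a Green function of an $\mathbb R$-Cartier divisor $D$ is a continuous real function $g$ on $U^{\mathrm{an}}$ for some non-empty Zariski open $U\subseteq X$ (two such functions being identified if they coincide on $V^{\mathrm{an}}$ for some non-empty Zariski open $V$) such that, for every local equation $s\in\operatorname{Rat}(X)^{\times}\otimes\mathbb R$ of $D$ on a non-empty Zariski open set $W$, the function $g+\log|s|$ extends to a continuous function on $W^{\mathrm{an}}$. The pair $(D,g)$ is called an adelic $\mathbb R$-Cartier divisor. It is effective if $D$ is a linear combination of effective Cartier divisors with positive real coefficients and $g\ge 0$ as a function $X^{\mathrm{an}}\to\mathbb R\cup\{+\infty\}$. Let $f:X\to X$ be a surjective endomorphism of $X$ over $K$, and let $D$ be an $\mathbb R$-Cartier divisor on $X$ with $\deg(D)\ge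 0$ such that $$f^*(D)=dD+(\varphi)\qquad\text{for some } d\in\mathbb R_{>1}\text{ and }\varphi\in\operatorname{Rat}(X)^{\times}\otimes\mathbb R .$$ Let $(D,g)$ be the canonical compactification of $D$ with respect to $f$, that is, $g$ is the Green function of $D$ satisfying $(f^{\mathrm{an}})^*(g)=dg-\log|\varphi|$. Then $(D,g)$ satisfies the Dirichlet property: there is $s\in\operatorname{Rat}(X)^{\times}\otimes\mathbb R$ such that $(D+(s),\,g-\log|s|)$ is an effective adelic $\mathbb R$-Cartier divisor. -/

import Mathlib

open AlgebraicGeometry CategoryTheory Filter Topology TopologicalSpace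
open scoped TensorProduct

universe u

namespace TrivialArakelov

noncomputable section

/-! ## Rational functions, Cartier divisors and real Cartier divisors -/

/-- The multiplicative group `Rat(X)ˣ` of non-zero rational functions on `X`. -/
def RatUnits (X : Scheme.{u}) [IsIntegral X] : Type u := (X.functionField)ˣ

instance (X : Scheme.{u}) [IsIntegral X] : CommGroup (RatUnits X) :=
  inferInstanceAs (CommGroup (X.functionField)ˣ)

/-- The inclusion `Rat(X)ˣ → Rat(X)`. -/
def RatUnits.val {X : Scheme.{u}} [IsIntegral X] : RatUnits X →* X.functionField :=
  Units.coeHom X.functionField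

lemma RatUnits.val_ne_zero {X : Scheme.{u}} [IsIntegral X] (φ : RatUnits X) : φ.val ≠ 0 :=
  Units.ne_zero (M₀ := X.functionField) φ

/-- The image of `𝒪_{X,x}ˣ` in `Rat(X)ˣ`. -/
def localUnits (X : Scheme.{u}) [IsIntegral X] (x : X) : Subgroup (RatUnits X) :=
  MonoidHom.range (G := (X.presheaf.stalk x)ˣ) (N := RatUnits X)
    (Units.map (algebraMap (X.presheaf.stalk x) X.functionField).toMonoidHom)

lemma mem_localUnits {X : Scheme.{u}} [IsIntegral X] {x : X} {φ : RatUnits X} :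
    φ ∈ localUnits X x ↔
      ∃ a : (X.presheaf.stalk x)ˣ, algebraMap (X.presheaf.stalk x) X.functionField a = φ.val :=
  exists_congr fun _ => Units.ext_iff

/-- The stalk `Rat(X)ˣ / 𝒪_{X,x}ˣ` of the sheaf `ℳ_Xˣ / 𝒪_Xˣ` at `x`, written additively. -/
def DivisorGerm (X : Scheme.{u}) [IsIntegral X] (x : X) : Type u :=
  Additive (RatUnits X ⧸ localUnits X x)

instance (X : Scheme.{u}) [IsIntegral X] (x : X) : AddCommGroup (DivisorGerm X x) :=
  inferInstanceAs (AddCommGroup (Additive (RatUnits X ⧸ localUnits X x)))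

/-- The germ at `x` of the principal divisor of a rational function. -/
def toGerm (X : Scheme.{u}) [IsIntegral X] (x : X) : Additive (RatUnits X) →+ DivisorGerm X x :=
  MonoidHom.toAdditive (QuotientGroup.mk' (localUnits X x))

/-- The group `Div(X) = H⁰(X, ℳ_Xˣ / 𝒪_Xˣ)` of Cartier divisors on an integral scheme: a section of
the quotient sheaf is a family of germs which is locally given by one rational function. -/
def CartierDivisor (X : Scheme.{u}) [IsIntegral X] : AddSubgroup (∀ x : X, DivisorGerm X x) where
  carrier := {D | ∀ x : X, ∃ U : X.Opens, x ∈ U ∧ ∃ φ : Additive (RatUnits X),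
    ∀ y ∈ U, D y = toGerm X y φ}
  zero_mem' := fun x => ⟨⊤, trivial, 0, fun y _ => by simp⟩
  add_mem' := by
    intro D E hD hE x
    obtain ⟨U, hxU, φ, hφ⟩ := hD x
    obtain ⟨V, hxV, ψ, hψ⟩ := hE x
    exact ⟨U ⊓ V, ⟨hxU, hxV⟩, φ + ψ, fun y hy => by
      simp [hφ y hy.1, hψ y hy.2]⟩
  neg_mem' := by
    intro D hD x
    obtain ⟨U, hxU, φ, hφ⟩ := hD x
    exact ⟨U, hxU, -φ, fun y hy => by simp [hφ y hy]⟩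

/-- The principal Cartier divisor `(φ)` of `φ ∈ Rat(X)ˣ`. -/
def principalInt (X : Scheme.{u}) [IsIntegral X] :
    Additive (RatUnits X) →+ CartierDivisor X where
  toFun φ := ⟨fun x => toGerm X x φ, fun _ => ⟨⊤, trivial, φ, fun _ _ => rfl⟩⟩
  map_zero' := by ext x; simp
  map_add' φ ψ := by ext x; simp

/-- `Pic(X) = Div(X) / PDiv(X)`. -/
abbrev PicGroup (X : Scheme.{u}) [IsIntegral X] : Type u :=
  CartierDivisor X ⧸ (principalInt X).range

/-- The rank of `Pic(X)`, i.e. `dim_ℚ (Pic(X) ⊗ ℚ)`, is one. -/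
def PicRankOne (X : Scheme.{u}) [IsIntegral X] : Prop :=
  Module.rank ℚ (ℚ ⊗[ℤ] PicGroup X) = 1

/-- A Cartier divisor is effective if its local equations are regular functions. -/
def EffectiveInt {X : Scheme.{u}} [IsIntegral X] (D : CartierDivisor X) : Prop :=
  ∀ x : X, ∃ (a : X.presheaf.stalk x) (φ : RatUnits X),
    algebraMap (X.presheaf.stalk x) X.functionField a = φ.val ∧ D.1 x = toGerm X x (Additive.ofMul φ)

/-- `Rat(X)ˣ_ℝ = Rat(X)ˣ ⊗ ℝ`, written additively. -/
abbrev RealRat (X : Scheme.{u}) [IsIntegral X] : Type u := ℝ ⊗[ℤ] Additive (RatUnits X)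

/-- `Div_ℝ(X) = Div(X) ⊗ ℝ`. -/
abbrev RealDivisor (X : Scheme.{u}) [IsIntegral X] : Type u := ℝ ⊗[ℤ] CartierDivisor X

/-- The `ℝ`-principal divisor `(φ)` of `φ ∈ Rat(X)ˣ_ℝ`. -/
def principalDivisor (X : Scheme.{u}) [IsIntegral X] : RealRat X →ₗ[ℝ] RealDivisor X :=
  (principalInt X).toIntLinearMap.baseChange ℝ

/-- The germ at `x` of an `ℝ`-Cartier divisor, in `(Rat(X)ˣ / 𝒪_{X,x}ˣ) ⊗ ℝ`. -/
def realGerm {X : Scheme.{u}} [IsIntegral X] (x : X) :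
    RealDivisor X →ₗ[ℝ] ℝ ⊗[ℤ] DivisorGerm X x :=
  (((Pi.evalAddMonoidHom (fun x : X => DivisorGerm X x) x).comp
    (CartierDivisor X).subtype).toIntLinearMap).baseChange ℝ

/-- `φ ∈ Rat(X)ˣ_ℝ` is a local equation of the `ℝ`-Cartier divisor `D` on `U`: the divisors `D` and
`(φ)` have the same germ at every point of `U`. -/
def IsLocalEquation {X : Scheme.{u}} [IsIntegral X] (D : RealDivisor X) (U : X.Opens)
    (φ : RealRat X) : Prop :=
  ∀ x ∈ U, realGerm x D = (toGerm X x).toIntLinearMap.baseChange ℝ φ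

/-- An `ℝ`-Cartier divisor is effective if it is a combination of effective Cartier divisors with
positive real coefficients. -/
def Effective {X : Scheme.{u}} [IsIntegral X] (D : RealDivisor X) : Prop :=
  ∃ (r : ℕ) (a : Fin r → ℝ) (E : Fin r → CartierDivisor X),
    (∀ i, 0 < a i) ∧ (∀ i, EffectiveInt (E i)) ∧ D = ∑ i, a i ⊗ₜ[ℤ] E i

/-! ## Pull-back by a surjective endomorphism -/

lemma specializes_genericPoint {X : Scheme.{u}} [IsIntegral X] (f : X ⟶ X) [Surjective f] :
    f (genericPoint X) ⤳ genericPoint X := by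
  obtain ⟨y, hy⟩ := f.surjective (genericPoint X)
  conv_rhs => rw [← hy]
  exact ((genericPoint_spec X).specializes (Set.mem_univ y)).map f.continuous

/-- The pull-back `f^* : Rat(X) → Rat(X)` of rational functions by a surjective endomorphism: the
map on stalks at the generic point, which is fixed by `f`. -/
def ratPullback {X : Scheme.{u}} [IsIntegral X] (f : X ⟶ X) [Surjective f] :
    X.functionField →+* X.functionField :=
  (X.presheaf.stalkSpecializes (specializes_genericPoint f) ≫ f.stalkMap (genericPoint X)).hom

lemma ratPullback_algebraMap {X : Scheme.{u}} [IsIntegral X] (f : X ⟶ X) [Surjective f] (x : X)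
    (a : X.presheaf.stalk (f x)) :
    ratPullback f (algebraMap (X.presheaf.stalk (f x)) X.functionField a) =
      algebraMap (X.presheaf.stalk x) X.functionField (f.stalkMap x a) := by
  have h := Scheme.Hom.stalkSpecializes_stalkMap_apply f (genericPoint X) x
    ((genericPoint_spec X).specializes (Set.mem_univ x)) a
  refine Eq.trans ?_ h
  exact congrArg (f.stalkMap (genericPoint X)) (TopCat.Presheaf.stalkSpecializes_comp_apply
    X.presheaf (specializes_genericPoint f)
    ((genericPoint_spec X).specializes (Set.mem_univ (f x))) a)

/-- `f^*` on `Rat(X)ˣ`. -/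
def unitPullback {X : Scheme.{u}} [IsIntegral X] (f : X ⟶ X) [Surjective f] :
    RatUnits X →* RatUnits X :=
  Units.map (M := X.functionField) (N := X.functionField) (ratPullback f).toMonoidHom

/-- `f^* : Rat(X)ˣ / 𝒪_{X,f(x)}ˣ → Rat(X)ˣ / 𝒪_{X,x}ˣ`. -/
def germPullback {X : Scheme.{u}} [IsIntegral X] (f : X ⟶ X) [Surjective f] (x : X) :
    DivisorGerm X (f x) →+ DivisorGerm X x :=
  MonoidHom.toAdditive (QuotientGroup.map (localUnits X (f x)) (localUnits X x) (unitPullback f) (by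
    intro φ h
    obtain ⟨u, hu⟩ := mem_localUnits.mp h
    refine mem_localUnits.mpr ⟨Units.map (f.stalkMap x).hom.toMonoidHom u, ?_⟩
    refine (ratPullback_algebraMap f x u).symm.trans ?_
    rw [hu]; rfl))

lemma germPullback_toGerm {X : Scheme.{u}} [IsIntegral X] (f : X ⟶ X) [Surjective f] (x : X)
    (φ : Additive (RatUnits X)) :
    germPullback f x (toGerm X (f x) φ) =
      toGerm X x (MonoidHom.toAdditive (unitPullback f) φ) := rfl

/-- The pull-back `f^*` of Cartier divisors. -/
def divisorPullbackInt {X : Scheme.{u}} [IsIntegral X] (f : X ⟶ X) [Surjective f] :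
    CartierDivisor X →+ CartierDivisor X where
  toFun D := ⟨fun x => germPullback f x (D.1 (f x)), fun x => by
    obtain ⟨U, hxU, φ, hφ⟩ := D.2 (f x)
    refine ⟨f ⁻¹ᵁ U, hxU, MonoidHom.toAdditive (unitPullback f) φ, fun y hy => ?_⟩
    exact (congrArg (germPullback f y) (hφ (f y) hy)).trans (germPullback_toGerm f y φ)⟩
  map_zero' := by ext x; simp
  map_add' D E := by ext x; simp

/-- The pull-back `f^*` of `ℝ`-Cartier divisors. -/
def divisorPullback {X : Scheme.{u}} [IsIntegral X] (f : X ⟶ X) [Surjective f] :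
    RealDivisor X →ₗ[ℝ] RealDivisor X :=
  (divisorPullbackInt f).toIntLinearMap.baseChange ℝ

/-! ## Projective curves and degrees -/

/-- The structure map `K → κ(x)` of a `K`-scheme `p : X ⟶ Spec K`. -/
def scalarMap {K : Type u} [Field K] {X : Scheme.{u}} (p : X ⟶ Spec (.of K)) (x : X) :
    K →+* X.residueField x :=
  ((Scheme.ΓSpecIso (.of K)).inv ≫ p.appTop ≫ X.Γevaluation x).hom

/-- The standard grading of `K[T₀, …, Tₙ]`. -/
instance (K : Type u) [Field K] (n : ℕ) :
    GradedAlgebra (MvPolynomial.homogeneousSubmodule (Fin (n + 1)) K) :=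
  MvPolynomial.gradedAlgebra

/-- `ℙⁿ_K = Proj K[T₀, …, Tₙ]` and its structure morphism to `Spec K`. -/
def projectiveSpaceHom (K : Type u) [Field K] (n : ℕ) :
    Proj (MvPolynomial.homogeneousSubmodule (Fin (n + 1)) K) ⟶ Spec (.of K) :=
  Proj.toSpecZero (MvPolynomial.homogeneousSubmodule (Fin (n + 1)) K) ≫
    Spec.map (CommRingCat.ofHom
      (algebraMap K (MvPolynomial.homogeneousSubmodule (Fin (n + 1)) K 0)))

/-- `X` is projective over `K`: it is a closed subscheme of some `ℙⁿ_K`. -/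
def IsProjective {K : Type u} [Field K] {X : Scheme.{u}} (p : X ⟶ Spec (.of K)) : Prop :=
  ∃ (n : ℕ) (i : X ⟶ Proj (MvPolynomial.homogeneousSubmodule (Fin (n + 1)) K)),
    IsClosedImmersion i ∧ i ≫ projectiveSpaceHom K n = p

/-- `p : X ⟶ Spec K` is a regular projective curve over `K`. -/
structure IsRegularProjectiveCurve {K : Type u} [Field K] {X : Scheme.{u}}
    (p : X ⟶ Spec (.of K)) : Prop where
  projective : IsProjective p
  regular : ∀ x : X, IsRegularLocalRing (X.presheaf.stalk x)
  dim_eq_one : topologicalKrullDim X = 1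

/-- `[κ(x) : K]`. -/
def residueDegree {K : Type u} [Field K] {X : Scheme.{u}} (p : X ⟶ Spec (.of K)) (x : X) : ℕ :=
  letI := (scalarMap p x).toAlgebra
  Module.finrank K (X.residueField x)

lemma ord_eq_zero_of_mem_localUnits {X : Scheme.{u}} [IsIntegral X] [IsLocallyNoetherian X] {x : X}
    {φ : RatUnits X} (h : φ ∈ localUnits X x) : Scheme.ord φ.val x = 0 := by
  obtain ⟨u, hu⟩ := mem_localUnits.mp h
  by_cases hx : Order.coheight x = 1
  · rw [Scheme.ord_eq_iff hx φ.val_ne_zero, ← hu]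
    have : Ring.KrullDimLE 1 (X.presheaf.stalk x) := krullDimLE_of_coheight_le hx.le
    exact Ring.ordFrac_of_isUnit u.isUnit
  · exact Scheme.ord_eq_zero_of_coheight_neq_one hx _

/-- The order `ord_x : Rat(X)ˣ → ℤ` at `x` (which is zero when `x` is not of codimension one). -/
def ordUnits {X : Scheme.{u}} [IsIntegral X] [IsLocallyNoetherian X] (x : X) :
    RatUnits X →* Multiplicative ℤ where
  toFun φ := Multiplicative.ofAdd (Scheme.ord φ.val x)
  map_one' := by
    rw [ord_eq_zero_of_mem_localUnits (one_mem _)]; rfl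
  map_mul' φ ψ := by
    rw [← ofAdd_add, map_mul, Scheme.ord_mul φ.val_ne_zero ψ.val_ne_zero]

/-- `ord_x : Rat(X)ˣ / 𝒪_{X,x}ˣ → ℤ`. -/
def ordGerm {X : Scheme.{u}} [IsIntegral X] [IsLocallyNoetherian X] (x : X) :
    DivisorGerm X x →+ ℤ :=
  MonoidHom.toAdditiveLeft (QuotientGroup.lift (localUnits X x) (ordUnits x) (fun φ h => by
    change Multiplicative.ofAdd _ = 1
    rw [ord_eq_zero_of_mem_localUnits h]; rfl))

/-- `ord_x(D)` for an `ℝ`-Cartier divisor `D`. -/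
def ordDivisor {X : Scheme.{u}} [IsIntegral X] [IsLocallyNoetherian X] (x : X) :
    RealDivisor X →ₗ[ℝ] ℝ :=
  ((((Int.castAddHom ℝ).comp (ordGerm x)).comp
    (Pi.evalAddMonoidHom (fun x : X => DivisorGerm X x) x)).comp
      (CartierDivisor X).subtype).toIntLinearMap.liftBaseChange ℝ

/-- The degree `deg(D) = ∑ₓ ord_x(D) [κ(x) : K]` of an `ℝ`-Cartier divisor on a projective curve
over `K`. Only points of codimension one (closed points) contribute, and only finitely many of
them do. -/
def degree {K : Type u} [Field K] {X : Scheme.{u}} [IsIntegral X] [IsLocallyNoetherian X]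
    (p : X ⟶ Spec (.of K)) (D : RealDivisor X) : ℝ :=
  ∑ᶠ x : X, ordDivisor x D * residueDegree p x

/-! ## The Berkovich space over a trivially valued field -/

/-- A point of the Berkovich space `X^an` of a scheme `X` over the trivially valued field `K`: a
point of `X` with an absolute value on its residue field which is trivial on `K`. -/
@[ext]
structure BerkovichSpace {K : Type u} [Field K] {X : Scheme.{u}} (p : X ⟶ Spec (.of K)) where
  pt : X
  abv : AbsoluteValue (X.residueField pt) ℝ
  abv_scalar : ∀ c : K, c ≠ 0 → abv (scalarMap p pt c) = 1

namespace BerkovichSpace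

variable {K : Type u} [Field K] {X : Scheme.{u}} {p : X ⟶ Spec (.of K)}

/-- `U^an ⊆ X^an`. -/
def zariskiOpen (p : X ⟶ Spec (.of K)) (U : X.Opens) : Set (BerkovichSpace p) := {ξ | ξ.pt ∈ U}

/-- `|s|(ξ)` for a regular function `s` on `U` and `ξ ∈ U^an`. -/
def absSection (ξ : BerkovichSpace p) (U : X.Opens) (h : ξ.pt ∈ U) (s : Γ(X, U)) : ℝ :=
  ξ.abv (X.evaluation U ξ.pt h s)

/-- The Berkovich topology: the coarsest topology for which `X^an → X` is continuous and, for every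
regular function `s` on a Zariski open set `U`, the function `|s|` is continuous on `U^an`. -/
instance : TopologicalSpace (BerkovichSpace p) :=
  TopologicalSpace.generateFrom
    ({S | ∃ U : X.Opens, S = zariskiOpen p U} ∪
      {S | ∃ (U : X.Opens) (s : Γ(X, U)) (V : Set ℝ), IsOpen V ∧
        S = {ξ | ∃ h : ξ.pt ∈ U, ξ.absSection U h s ∈ V}})

lemma isOpen_zariskiOpen (p : X ⟶ Spec (.of K)) (U : X.Opens) : IsOpen (zariskiOpen p U) :=
  TopologicalSpace.isOpen_generateFrom_of_mem (Or.inl ⟨U, rfl⟩)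

lemma isOpen_absSection (U : X.Opens) (s : Γ(X, U)) {V : Set ℝ} (hV : IsOpen V) :
    IsOpen {ξ : BerkovichSpace p | ∃ h : ξ.pt ∈ U, ξ.absSection U h s ∈ V} :=
  TopologicalSpace.isOpen_generateFrom_of_mem (Or.inr ⟨U, s, V, hV, rfl⟩)

/-- The filter of sets containing `U^an` for some non-empty Zariski open set `U`. -/
def generic (p : X ⟶ Spec (.of K)) [IsIntegral X] : Filter (BerkovichSpace p) where
  sets := {S | ∃ U : X.Opens, (U : Set X).Nonempty ∧ zariskiOpen p U ⊆ S}
  univ_sets := ⟨⊤, Set.univ_nonempty, Set.subset_univ _⟩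
  sets_of_superset := fun ⟨U, hU, h⟩ h' => ⟨U, hU, h.trans h'⟩
  inter_sets := fun ⟨U, hU, h⟩ ⟨V, hV, h'⟩ =>
    ⟨U ⊓ V, nonempty_preirreducible_inter U.isOpen V.isOpen hU hV,
      fun _ hξ => ⟨h hξ.1, h' hξ.2⟩⟩

lemma zariskiOpen_mem_generic (p : X ⟶ Spec (.of K)) [IsIntegral X] {U : X.Opens}
    (hU : (U : Set X).Nonempty) : zariskiOpen p U ∈ generic p := ⟨U, hU, subset_rfl⟩

/-- The map `f^an : X^an → X^an` of a `K`-morphism `f : X ⟶ X`. -/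
def map (f : X ⟶ X) (hf : f ≫ p = p) (ξ : BerkovichSpace p) : BerkovichSpace p where
  pt := f ξ.pt
  abv := ξ.abv.comp (f.residueFieldMap ξ.pt).hom.injective
  abv_scalar c hc := by
    have key : (f.residueFieldMap ξ.pt).hom (scalarMap p (f ξ.pt) c) = scalarMap p ξ.pt c := by
      have h := Scheme.Γevaluation_naturality_apply f ξ.pt
        (p.appTop ((Scheme.ΓSpecIso (.of K)).inv c))
      refine h.trans ?_
      change X.Γevaluation ξ.pt (f.appTop (p.appTop _)) = X.Γevaluation ξ.pt (p.appTop _)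
      have h2 : p.appTop ≫ f.appTop = p.appTop := by
        rw [← Scheme.Hom.comp_appTop, hf]
      exact congrArg (X.Γevaluation ξ.pt)
        (DFunLike.congr_fun (CommRingCat.hom_ext_iff.mp h2) ((Scheme.ΓSpecIso (.of K)).inv c))
    change ξ.abv ((f.residueFieldMap ξ.pt).hom (scalarMap p (f ξ.pt) c)) = 1
    rw [key, ξ.abv_scalar c hc]

lemma continuous_map (f : X ⟶ X) (hf : f ≫ p = p) : Continuous (map f hf) := by
  refine continuous_generateFrom_iff.mpr ?_
  rintro S (⟨U, rfl⟩ | ⟨U, s, V, hV, rfl⟩)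
  · exact isOpen_zariskiOpen p (f ⁻¹ᵁ U)
  · convert isOpen_absSection (p := p) (f ⁻¹ᵁ U) (f.app U s) hV using 1
    ext ξ
    refine exists_congr fun h => ?_
    exact iff_of_eq (congrArg (fun a => ξ.abv a ∈ V)
      (Scheme.evaluation_naturality_apply f ξ.pt h s))

lemma tendsto_map [IsIntegral X] (f : X ⟶ X) [Surjective f] (hf : f ≫ p = p) :
    Tendsto (map f hf) (generic p) (generic p) := by
  rintro S ⟨U, ⟨y, hy⟩, h⟩
  obtain ⟨x, rfl⟩ := f.surjective y
  exact ⟨f ⁻¹ᵁ U, ⟨x, hy⟩, fun ξ hξ => h hξ⟩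

lemma absSection_ne_zero {U : X.Opens} {s : Γ(X, U)}
    (hs : X.basicOpen s = U) (ξ : BerkovichSpace p) (hξ : ξ.pt ∈ U) :
    ξ.absSection U hξ s ≠ 0 := by
  rw [absSection, ne_eq, map_eq_zero, ← ne_eq, Scheme.evaluation_ne_zero_iff_mem_basicOpen, hs]
  exact hξ

end BerkovichSpace

open BerkovichSpace

/-! ## Green functions -/

section Green

variable {K : Type u} [Field K] {X : Scheme.{u}} [IsIntegral X]

/-- The space `Ĉ⁰(X^an)` of continuous functions on non-empty Zariski open subsets of `X^an`, two of
them being identified if they coincide on a non-empty Zariski open subset. -/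
def GenericFunction (p : X ⟶ Spec (.of K)) : Submodule ℝ (Germ (generic p) ℝ) where
  carrier := {γ | ∃ U : X.Opens, (U : Set X).Nonempty ∧
    ∃ h : BerkovichSpace p → ℝ, ContinuousOn h (zariskiOpen p U) ∧ γ = (h : Germ (generic p) ℝ)}
  zero_mem' := ⟨⊤, Set.univ_nonempty, 0, continuousOn_const, rfl⟩
  add_mem' := by
    rintro _ _ ⟨U, hU, h, hh, rfl⟩ ⟨V, hV, k, hk, rfl⟩
    exact ⟨U ⊓ V, nonempty_preirreducible_inter U.isOpen V.isOpen hU hV, h + k,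
      (hh.mono fun _ hξ => hξ.1).add (hk.mono fun _ hξ => hξ.2), rfl⟩
  smul_mem' := by
    rintro c _ ⟨U, hU, h, hh, rfl⟩
    exact ⟨U, hU, c • h, hh.const_smul c, rfl⟩

/-- `γ ∈ Ĉ⁰(X^an)` extends to a continuous function on `U^an`. -/
def ExtendsTo {p : X ⟶ Spec (.of K)} (γ : GenericFunction p) (U : X.Opens) : Prop :=
  ∃ h : BerkovichSpace p → ℝ, ContinuousOn h (zariskiOpen p U) ∧ γ.1 = (h : Germ (generic p) ℝ)

/-- The value `|φ|(ξ)` of a rational function `φ` which is regular at the point of `X` below `ξ`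
(and `0` if `φ` is not regular there). -/
def absRat {p : X ⟶ Spec (.of K)} (φ : X.functionField) (ξ : BerkovichSpace p) : ℝ :=
  open Classical in
  if h : ∃ a : X.presheaf.stalk ξ.pt, algebraMap (X.presheaf.stalk ξ.pt) X.functionField a = φ
  then ξ.abv (X.residue ξ.pt h.choose) else 0

lemma algebraMap_stalk_injective (x : X) :
    Function.Injective (algebraMap (X.presheaf.stalk x) X.functionField) :=
  IsFractionRing.injective _ _

lemma absRat_eq {p : X ⟶ Spec (.of K)} {φ : X.functionField} {ξ : BerkovichSpace p}
    {a : X.presheaf.stalk ξ.pt}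
    (h : algebraMap (X.presheaf.stalk ξ.pt) X.functionField a = φ) :
    absRat φ ξ = ξ.abv (X.residue ξ.pt a) := by
  have h' : ∃ a, algebraMap (X.presheaf.stalk ξ.pt) X.functionField a = φ := ⟨a, h⟩
  rw [absRat, dif_pos h', algebraMap_stalk_injective ξ.pt (h'.choose_spec.trans h.symm)]

/-- A non-zero rational function is an invertible regular function on a non-empty open set. -/
lemma exists_unit_section (φ : RatUnits X) :
    ∃ (U : X.Opens) (s : Γ(X, U)), (U : Set X).Nonempty ∧
      (∀ x (hx : x ∈ U), algebraMap (X.presheaf.stalk x) X.functionField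
        (X.presheaf.germ U x hx s) = φ.val) ∧ X.basicOpen s = U := by
  obtain ⟨U, hU, s, hs⟩ := X.presheaf.exists_germ_eq (φ.val : X.functionField)
  have hη : genericPoint X ∈ X.basicOpen s := by
    rw [Scheme.mem_basicOpen _ _ _ hU, hs]
    exact Units.isUnit (M := X.functionField) φ
  refine ⟨X.basicOpen s, X.presheaf.map (homOfLE (X.basicOpen_le s)).op s, ⟨_, hη⟩,
    fun x hx => ?_, ?_⟩
  · have : Nonempty U := ⟨⟨_, hU⟩⟩
    rw [TopCat.Presheaf.germ_res_apply, Scheme.algebraMap_germ_eq_germToFunctionField]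
    exact hs
  · rw [Scheme.basicOpen_res]; simp

lemma absRat_section {p : X ⟶ Spec (.of K)} {φ : X.functionField} {U : X.Opens} {s : Γ(X, U)}
    (h : ∀ x (hx : x ∈ U), algebraMap (X.presheaf.stalk x) X.functionField
        (X.presheaf.germ U x hx s) = φ) (ξ : BerkovichSpace p) (hξ : ξ.pt ∈ U) :
    absRat φ ξ = ξ.absSection U hξ s := absRat_eq (h _ hξ)

lemma continuousOn_log_absRat {p : X ⟶ Spec (.of K)} {φ : X.functionField} {U : X.Opens}
    {s : Γ(X, U)} (h : ∀ x (hx : x ∈ U), algebraMap (X.presheaf.stalk x) X.functionField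
        (X.presheaf.germ U x hx s) = φ) (hs : X.basicOpen s = U) :
    ContinuousOn (fun ξ : BerkovichSpace p => Real.log (absRat φ ξ)) (zariskiOpen p U) := by
  have h1 : ContinuousOn (fun ξ : BerkovichSpace p => absRat φ ξ) (zariskiOpen p U) := by
    rw [continuousOn_iff']
    intro V hV
    refine ⟨_, isOpen_absSection U s hV, ?_⟩
    ext ξ
    constructor
    · rintro ⟨h2, h3⟩
      exact ⟨⟨h3, by rw [← absRat_section h ξ h3]; exact h2⟩, h3⟩
    · rintro ⟨⟨h2, h3⟩, h4⟩
      refine ⟨?_, h4⟩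
      change absRat φ ξ ∈ V
      rw [absRat_section h ξ h4]; exact h3
  refine h1.log fun ξ hξ => ?_
  rw [absRat_section h ξ hξ]
  exact absSection_ne_zero hs ξ hξ

/-- The homomorphism `Rat(X)ˣ → Ĉ⁰(X^an)`, `φ ↦ log |φ|`. -/
def logAbsInt (p : X ⟶ Spec (.of K)) : Additive (RatUnits X) →+ GenericFunction p :=
  AddMonoidHom.mk'
    (fun φ => ⟨((fun ξ => Real.log (absRat (RatUnits.val φ.toMul) ξ) :
        BerkovichSpace p → ℝ) : Germ (generic p) ℝ), by
      obtain ⟨U, s, hU, h, hs⟩ := exists_unit_section φ.toMul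
      exact ⟨U, hU, _, continuousOn_log_absRat h hs, rfl⟩⟩)
    (fun φ ψ => by
      obtain ⟨U, s, hU, h, hs⟩ := exists_unit_section φ.toMul
      obtain ⟨V, t, hV, k, ht⟩ := exists_unit_section ψ.toMul
      refine Subtype.ext (Germ.coe_eq.mpr ?_)
      filter_upwards [zariskiOpen_mem_generic p hU, zariskiOpen_mem_generic p hV] with ξ hξ hξ'
      have e : absRat (RatUnits.val (φ + ψ).toMul) ξ =
          absRat (RatUnits.val φ.toMul) ξ * absRat (RatUnits.val ψ.toMul) ξ := by
        rw [absRat_eq (h _ hξ), absRat_eq (k _ hξ'), ← map_mul, ← map_mul]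
        refine absRat_eq ?_
        rw [map_mul, h _ hξ, k _ hξ']
        rfl
      have e1 := absSection_ne_zero hs ξ hξ
      have e2 := absSection_ne_zero ht ξ hξ'
      rw [← absRat_section h ξ hξ] at e1
      rw [← absRat_section k ξ hξ'] at e2
      change Real.log _ = Real.log _ + Real.log _
      rw [e, Real.log_mul e1 e2])

/-- The `ℝ`-linear extension `Rat(X)ˣ_ℝ → Ĉ⁰(X^an)`, `φ ↦ log |φ|`. -/
def logAbs (p : X ⟶ Spec (.of K)) : RealRat X →ₗ[ℝ] GenericFunction p :=
  (logAbsInt p).toIntLinearMap.liftBaseChange ℝ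

/-- The pull-back `(f^an)^*` on `Ĉ⁰(X^an)`. -/
def genericPullback {p : X ⟶ Spec (.of K)} (f : X ⟶ X) [Surjective f] (hf : f ≫ p = p)
    (γ : GenericFunction p) : GenericFunction p :=
  ⟨γ.1.compTendsto (BerkovichSpace.map f hf) (tendsto_map f hf), by
    obtain ⟨_, U, ⟨y, hy⟩, h, hh, rfl⟩ := γ
    obtain ⟨x, rfl⟩ := f.surjective y
    exact ⟨f ⁻¹ᵁ U, ⟨x, hy⟩, h ∘ BerkovichSpace.map f hf,
      hh.comp (continuous_map f hf).continuousOn fun ξ hξ => hξ, rfl⟩⟩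

/-- `g` is a Green function (of `C⁰`-type) of the `ℝ`-Cartier divisor `D`. -/
def IsGreenFunction {p : X ⟶ Spec (.of K)} (D : RealDivisor X) (g : GenericFunction p) : Prop :=
  ∀ (U : X.Opens) (φ : RealRat X), (U : Set X).Nonempty → IsLocalEquation D U φ →
    ExtendsTo (g + logAbs p φ) U

/-- An adelic `ℝ`-Cartier divisor `(D, g)` on `X`. -/
structure AdelicDivisor (p : X ⟶ Spec (.of K)) where
  divisor : RealDivisor X
  green : GenericFunction p
  isGreen : IsGreenFunction divisor green

namespace AdelicDivisor

variable {p : X ⟶ Spec (.of K)}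

/-- `(D, g)` is effective: `D` is effective and `g ≥ 0` as a map `X^an → ℝ ∪ {+∞}`. This map is
`-log E`, where `E` is the continuous extension of `exp(-g)` to `X^an`, so it is non-negative if and
only if `E ≤ 1`. -/
def Effective (A : AdelicDivisor p) : Prop :=
  TrivialArakelov.Effective A.divisor ∧
    ∃ E : BerkovichSpace p → ℝ, Continuous E ∧ (∀ ξ, 0 ≤ E ξ) ∧
      A.green.1.map (fun t => Real.exp (-t)) = (E : Germ (generic p) ℝ) ∧ ∀ ξ, E ξ ≤ 1

/-- `ℝ`-linear equivalence: `B - A` is the principal adelic divisor `((s), -log |s|)` for some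
`s ∈ Rat(X)ˣ_ℝ`. -/
def LinearlyEquivalent (A B : AdelicDivisor p) : Prop :=
  ∃ s : RealRat X, B.divisor = A.divisor + principalDivisor X s ∧ B.green = A.green - logAbs p s

/-- The Dirichlet property: `A` is `ℝ`-linearly equivalent to an effective adelic divisor. -/
def DirichletProperty (A : AdelicDivisor p) : Prop :=
  ∃ B : AdelicDivisor p, A.LinearlyEquivalent B ∧ B.Effective

/-- `A = (D, g)` is the canonical compactification of `D` with respect to `f`, where
`f^* D = d D + (φ)`: the Green function `g` of `D` satisfies `(f^an)^* g = d g - log |φ|`. -/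
def IsCanonicalCompactification (A : AdelicDivisor p) (D : RealDivisor X) (f : X ⟶ X)
    [Surjective f] (hf : f ≫ p = p) (d : ℝ) (φ : RealRat X) : Prop :=
  A.divisor = D ∧ genericPullback f hf A.green = d • A.green - logAbs p φ

end AdelicDivisor

end Green

end

end TrivialArakelov

namespace TrivialArakelov

/-! ## Geometry of regular projective curves -/

section Geometry

variable {K : Type u} [Field K] {X : Scheme.{u}} {p : X ⟶ Spec (.of K)}

/-! Points of `X^an` above the generic point are absolute values `v` on `Rat(X)` that are trivial on
`K`. By properness each has a center `x`, meaning that `v` is at most one on the local ring at `x`.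
Since units at `x` then have absolute value one, a local equation of `D` at `x` has a well-defined
logarithm `divLog`, and one may form the defect `g(v) + log |D|(v)`.

Two facts force the defect to vanish. The functional equations of `D` and `g` give `defect(f(v)) = d
* defect(v)` (`GenericAbs.defect_pullback`). The Green function condition makes the defect bounded
(`exists_bound_eval_add_divLog`): `X^an` is a star whose branches, one for each closed point, are
compact intervals, and all but finitely many of them lie in any given neighbourhood of the trivial
absolute value. As `d > 1`, iterating `f` leaves only zero (`GenericAbs.eval_add_divLog_eq_zero`).
So the canonical Green function is `-log |D|`.

It remains to make `D` effective. As `Pic(X)` has rank one, any two closed points are the zero and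
the pole of a rational function (`exists_ord_of_picRankOne`), and a dimension count shows that such
a function has divisor of degree zero (`mul_residueDegree_eq`). Hence `D` is linearly equivalent to
`c • y` for a closed point `y`, with `c = deg D / deg y ≥ 0` (`exists_eq_smul_pointDivisor`). The
defect is invariant under linear equivalence, so the new Green function is `-c * log |y|`. It is
non-negative at every `v`, because local equations of `y` are regular at the center. Points above
the generic point are dense, so the inequality extends to `X^an` (`exists_effective_extension`). -/

/-- The degree zero part of `K[T₀, …, Tₙ]` is `K`, and `Proj` of an algebra of finite type over its
degree zero part is proper over that part. -/
lemma isProper_projectiveSpaceHom (K : Type u) [Field K] (n : ℕ) :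
    IsProper (projectiveSpaceHom K n) := by
  have h0 : Function.Bijective (algebraMap K (MvPolynomial.homogeneousSubmodule (Fin (n + 1)) K 0)) := by
    refine ⟨fun a b h => MvPolynomial.C_injective _ _ (congrArg Subtype.val h), ?_⟩
    rintro ⟨q, hq⟩
    rw [MvPolynomial.homogeneousSubmodule_zero] at hq
    obtain ⟨c, rfl⟩ := Submodule.mem_one.mp hq
    exact ⟨c, Subtype.ext rfl⟩
  have : IsIso (Spec.map (CommRingCat.ofHom
      (algebraMap K (MvPolynomial.homogeneousSubmodule (Fin (n + 1)) K 0)))) := by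
    have : IsIso (CommRingCat.ofHom
      (algebraMap K (MvPolynomial.homogeneousSubmodule (Fin (n + 1)) K 0))) := by
      rw [ConcreteCategory.isIso_iff_bijective]
      exact h0
    infer_instance
  have : Algebra.FiniteType (MvPolynomial.homogeneousSubmodule (Fin (n + 1)) K 0)
      (MvPolynomial (Fin (n + 1)) K) := by
    rw [← RingHom.finiteType_algebraMap]
    refine RingHom.FiniteType.of_comp_finiteType
      (f := algebraMap K (MvPolynomial.homogeneousSubmodule (Fin (n + 1)) K 0)) ?_
    exact (RingHom.finiteType_algebraMap (A := K) (B := MvPolynomial (Fin (n + 1)) K)).mpr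
      inferInstance
  unfold projectiveSpaceHom
  infer_instance

lemma IsProjective.isProper (h : IsProjective p) : IsProper p := by
  obtain ⟨n, i, hi, rfl⟩ := h
  have := isProper_projectiveSpaceHom K n
  infer_instance

/-- The structure map `K → 𝒪_{X,x}`. -/
noncomputable def stalkScalar (p : X ⟶ Spec (.of K)) (x : X) : K →+* X.presheaf.stalk x :=
  ((Scheme.ΓSpecIso (.of K)).inv ≫ p.appTop ≫ X.presheaf.germ ⊤ x trivial).hom

lemma fromSpecStalk_comp (p : X ⟶ Spec (.of K)) (x : X) :
    X.fromSpecStalk x ≫ p = Spec.map (CommRingCat.ofHom (stalkScalar p x)) := by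
  refine ext_of_isAffine ?_
  rw [← cancel_epi (Scheme.ΓSpecIso (.of K)).inv]
  rw [← Scheme.ΓSpecIso_inv_naturality, stalkScalar, CommRingCat.ofHom_hom,
    Scheme.Hom.comp_appTop, Scheme.fromSpecStalk_appTop]
  simp only [Category.assoc]
  congr 3

variable [IsIntegral X]

/-- In the specialization order the generic point is the top element, so the coheight is the
codimension. It is bounded by the dimension of `X`, and vanishes only at maximal points. -/
lemma coheight_eq_one (hX : IsRegularProjectiveCurve p) {x : X} (hx : x ≠ genericPoint X) :
    Order.coheight x = 1 := by
  have hlt : x < genericPoint X := by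
    have h := (genericPoint_spec X).specializes (Set.mem_univ x)
    exact ⟨h, fun h' => hx (Specializes.antisymm h' h).eq⟩
  have hdim : Order.krullDim X = 1 := by
    rw [← hX.dim_eq_one, topologicalKrullDim]
    exact (Order.krullDim_eq_of_orderIso (irreducibleSetEquivPoints (α := X))).symm
  have h1 : (Order.coheight x : WithBot ℕ∞) ≤ 1 := hdim ▸ Order.coheight_le_krullDim x
  refine le_antisymm (by exact_mod_cast h1) ?_
  rw [Order.one_le_iff_pos, pos_iff_ne_zero, ne_eq, Order.coheight_eq_zero]
  exact fun h => hlt.not_isMax h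

lemma isClosed_singleton (hX : IsRegularProjectiveCurve p) {x : X} (hx : x ≠ genericPoint X) :
    IsClosed ({x} : Set X) := by
  rw [← closure_subset_iff_isClosed]
  intro y hy
  have hyx : y ≤ x := specializes_iff_mem_closure.mpr hy
  by_contra hne
  have hlt : y < x := ⟨hyx, fun h => hne (Specializes.antisymm hyx h).symm.eq⟩
  have h1 := Order.coheight_add_one_le hlt
  by_cases hy' : y = genericPoint X
  · subst hy'
    exact hx (Specializes.antisymm hyx ((genericPoint_spec X).specializes (Set.mem_univ x))).eq
  · rw [coheight_eq_one hX hx, coheight_eq_one hX hy'] at h1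
    norm_num at h1

/-- Regularity in dimension one says that the cotangent space is one-dimensional, which
characterizes discrete valuation rings. -/
lemma isDiscreteValuationRing_stalk (hX : IsRegularProjectiveCurve p) {x : X}
    (hx : x ≠ genericPoint X) : IsDiscreteValuationRing (X.presheaf.stalk x) := by
  have := hX.regular x
  have hd : ringKrullDim (X.presheaf.stalk x) = 1 := by
    rw [ringKrullDim_stalk_eq_coheight, coheight_eq_one hX hx]; rfl
  have hf : ¬ IsField (X.presheaf.stalk x) := fun h => by
    rw [ringKrullDim_eq_zero_of_isField h] at hd
    norm_num at hd
  refine ((IsDiscreteValuationRing.TFAE _ hf).out 5 0).mp ?_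
  have h := (IsRegularLocalRing.iff_finrank_cotangentSpace _).mp this
  rw [hd] at h
  exact_mod_cast h

/-- The complement is a finite union of irreducible closed sets. Their generic points differ from
that of `X`, so they are closed points and each set is a singleton. -/
lemma finite_compl_of_nonempty (hX : IsRegularProjectiveCurve p) [IsLocallyNoetherian X]
    {U : X.Opens} (hU : (U : Set X).Nonempty) : ((U : Set X)ᶜ).Finite := by
  have := hX.projective.isProper
  have : CompactSpace X := (quasiCompact_iff_compactSpace p).mp inferInstance
  have : IsNoetherian X := {}
  obtain ⟨S, hS, hSc, hSi, hUS⟩ := NoetherianSpace.exists_finite_set_isClosed_irreducible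
    U.isOpen.isClosed_compl
  have hη : genericPoint X ∈ U :=
    ((genericPoint_spec X).mem_open_set_iff U.isOpen).mpr (by simpa using hU)
  rw [hUS]
  refine hS.sUnion fun t ht => ?_
  obtain ⟨x, hx⟩ := QuasiSober.sober (hSi t ht) (hSc t ht)
  have hxt : x ∈ t := hx.mem
  have hxη : x ≠ genericPoint X := by
    rintro rfl
    have : genericPoint X ∈ (U : Set X)ᶜ := by rw [hUS]; exact ⟨t, ht, hxt⟩
    exact this hη
  have : t = {x} := by rw [← hx.def, (isClosed_singleton hX hxη).closure_eq]
  rw [this]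
  exact Set.finite_singleton x

/-- This is the Nullstellensatz: the spectrum of the residue field at a closed point is of finite
type over `K`. -/
lemma finite_residueField (hX : IsRegularProjectiveCurve p) {x : X}
    (hx : x ≠ genericPoint X) : (scalarMap p x).Finite := by
  have := hX.projective.isProper
  have hc := isClosed_singleton_iff_isClosedImmersion.mp (isClosed_singleton hX hx)
  have : IsFinite (X.fromSpecResidueField x ≫ p) := by
    rw [isFinite_iff_locallyOfFiniteType_of_jacobsonSpace]
    infer_instance
  rw [Scheme.fromSpecResidueField, Category.assoc, fromSpecStalk_comp, ← Spec.map_comp,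
    IsFinite.SpecMap_iff] at this
  exact this

end Geometry
end TrivialArakelov

namespace TrivialArakelov

/-! ## Orders of vanishing -/

section Order

variable {K : Type u} [Field K] {X : Scheme.{u}} {p : X ⟶ Spec (.of K)} [IsIntegral X]

/-- The local ring of `X` at `x` as a subring of the function field. -/
noncomputable def localRing (x : X) : Subring X.functionField :=
  (algebraMap (X.presheaf.stalk x) X.functionField).range

lemma algebraMap_stalk_eq (x : X) (U : X.Opens) (hx : x ∈ U) (hη : genericPoint X ∈ U)
    (s : Γ(X, U)) :
    algebraMap (X.presheaf.stalk x) X.functionField (X.presheaf.germ U x hx s) =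
      X.presheaf.germ U (genericPoint X) hη s := by
  have : Nonempty U := ⟨⟨x, hx⟩⟩
  exact Scheme.algebraMap_germ_eq_germToFunctionField X hx s

lemma mem_genericPoint {U : X.Opens} (hU : (U : Set X).Nonempty) : genericPoint X ∈ U :=
  ((genericPoint_spec X).mem_open_set_iff U.isOpen).mpr (by simpa using hU)

/-- The algebra structure on the stalk at the generic point is a specialization map, which has to be
identified with the identity. -/
lemma algebraMap_genericPoint (a : X.functionField) :
    @algebraMap _ _ _ _ (stalkFunctionFieldAlgebra X (genericPoint X)) a = a := by
  obtain ⟨U, hU, s, rfl⟩ := X.presheaf.exists_germ_eq a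
  exact algebraMap_stalk_eq _ U hU hU s

variable [IsLocallyNoetherian X]

lemma ord_one (x : X) : Scheme.ord (1 : X.functionField) x = 0 := by
  have := Scheme.ord_mul (x := x) (one_ne_zero (α := X.functionField)) one_ne_zero
  rw [one_mul] at this
  linarith

lemma ord_inv (x : X) {a : X.functionField} (ha : a ≠ 0) :
    Scheme.ord a⁻¹ x = - Scheme.ord a x := by
  have := Scheme.ord_mul (x := x) ha (inv_ne_zero ha)
  rw [mul_inv_cancel₀ ha, ord_one] at this
  linarith

lemma ord_pow (x : X) {a : X.functionField} (ha : a ≠ 0) (n : ℕ) :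
    Scheme.ord (a ^ n) x = n * Scheme.ord a x := by
  induction n with
  | zero => simp [ord_one]
  | succ n ih =>
    rw [pow_succ, Scheme.ord_mul (pow_ne_zero n ha) ha, ih]
    push_cast; ring

lemma ord_of_isUnit {x : X} {b : X.presheaf.stalk x} (hb : IsUnit b) :
    Scheme.ord (algebraMap (X.presheaf.stalk x) X.functionField b) x = 0 := by
  obtain ⟨u, rfl⟩ := hb
  exact ord_eq_zero_of_mem_localUnits
    (φ := Units.map (algebraMap (X.presheaf.stalk x) X.functionField).toMonoidHom u)
    (mem_localUnits.mpr ⟨u, rfl⟩)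

lemma ord_of_irreducible (hX : IsRegularProjectiveCurve p) {x : X} (hx : x ≠ genericPoint X)
    {b : X.presheaf.stalk x} (hb : Irreducible b) :
    Scheme.ord (algebraMap (X.presheaf.stalk x) X.functionField b) x = 1 := by
  have := isDiscreteValuationRing_stalk hX hx
  have h1 := coheight_eq_one hX hx
  have h0 : algebraMap (X.presheaf.stalk x) X.functionField b ≠ 0 := by
    rw [ne_eq, map_eq_zero_iff _ (algebraMap_stalk_injective x)]
    exact hb.ne_zero
  rw [Scheme.ord_eq_iff h1 h0]
  exact Ring.ordFrac_irreducible hb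

lemma ord_of_irreducible_pow (hX : IsRegularProjectiveCurve p) {x : X} (hx : x ≠ genericPoint X)
    {b u : X.presheaf.stalk x} (hb : Irreducible b) (hu : IsUnit u) (n : ℕ) :
    Scheme.ord (algebraMap (X.presheaf.stalk x) X.functionField (u * b ^ n)) x = n := by
  have hi := algebraMap_stalk_injective x
  have h0 : algebraMap (X.presheaf.stalk x) X.functionField b ≠ 0 := by
    rw [ne_eq, map_eq_zero_iff _ hi]
    exact hb.ne_zero
  have h1 : algebraMap (X.presheaf.stalk x) X.functionField u ≠ 0 := by
    rw [ne_eq, map_eq_zero_iff _ hi]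
    exact hu.ne_zero
  rw [map_mul, map_pow, Scheme.ord_mul h1 (pow_ne_zero _ h0), ord_of_isUnit hu, ord_pow _ h0,
    ord_of_irreducible hX hx hb]
  ring

lemma ord_nonneg_of_mem (hX : IsRegularProjectiveCurve p) {x : X} (hx : x ≠ genericPoint X)
    {a : X.functionField} (ha : a ∈ localRing x) : 0 ≤ Scheme.ord a x := by
  obtain ⟨b, rfl⟩ := ha
  have := isDiscreteValuationRing_stalk hX hx
  by_cases hb : b = 0
  · simp [hb]
  obtain ⟨ϖ, hϖ⟩ := IsDiscreteValuationRing.exists_irreducible (X.presheaf.stalk x)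
  obtain ⟨n, u, rfl⟩ := IsDiscreteValuationRing.eq_unit_mul_pow_irreducible hb hϖ
  have := ord_of_irreducible_pow hX hx hϖ u.isUnit n
  exact this.symm ▸ Int.natCast_nonneg n

/-- Numerator and denominator are each a unit times a power of `ϖ`. The order is the difference of
the two exponents, so when it is non-negative the power in the denominator cancels. -/
lemma exists_eq_of_ord_nonneg (hX : IsRegularProjectiveCurve p) {x : X} (hx : x ≠ genericPoint X)
    {ϖ : X.presheaf.stalk x} (hϖ : Irreducible ϖ) {a : X.functionField} (ha : a ≠ 0)
    (h : 0 ≤ Scheme.ord a x) : ∃ u : X.presheaf.stalk x, IsUnit u ∧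
      algebraMap (X.presheaf.stalk x) X.functionField (u * ϖ ^ (Scheme.ord a x).toNat) = a := by
  have := isDiscreteValuationRing_stalk hX hx
  have hi := algebraMap_stalk_injective x
  obtain ⟨b, c, hc, rfl⟩ := IsFractionRing.div_surjective (A := X.presheaf.stalk x) a
  have hc0 : c ≠ 0 := nonZeroDivisors.ne_zero hc
  have hb0 : b ≠ 0 := by rintro rfl; simp at ha
  obtain ⟨n, u, rfl⟩ := IsDiscreteValuationRing.eq_unit_mul_pow_irreducible hb0 hϖ
  obtain ⟨m, w, rfl⟩ := IsDiscreteValuationRing.eq_unit_mul_pow_irreducible hc0 hϖ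
  have hb1 : algebraMap (X.presheaf.stalk x) X.functionField (u * ϖ ^ n) ≠ 0 := by
    rwa [ne_eq, map_eq_zero_iff _ hi]
  have hc1 : algebraMap (X.presheaf.stalk x) X.functionField (w * ϖ ^ m) ≠ 0 := by
    rwa [ne_eq, map_eq_zero_iff _ hi]
  have ho : Scheme.ord (algebraMap (X.presheaf.stalk x) X.functionField (u * ϖ ^ n) /
      algebraMap (X.presheaf.stalk x) X.functionField (w * ϖ ^ m)) x = n - m := by
    rw [div_eq_mul_inv, Scheme.ord_mul hb1 (inv_ne_zero hc1), ord_inv x hc1,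
      ord_of_irreducible_pow hX hx hϖ u.isUnit, ord_of_irreducible_pow hX hx hϖ w.isUnit]
    ring
  rw [ho] at h ⊢
  obtain ⟨k, rfl⟩ : ∃ k, n = m + k := Nat.exists_eq_add_of_le (by omega)
  refine ⟨u * ↑w⁻¹, u.isUnit.mul w⁻¹.isUnit, ?_⟩
  rw [eq_div_iff hc1, ← map_mul]
  congr 1
  have : ((m + k : ℕ) - m : ℤ).toNat = k := by omega
  rw [this]
  calc (u * ↑w⁻¹ * ϖ ^ k * (w * ϖ ^ m) : X.presheaf.stalk x)
      = u * (↑w⁻¹ * w) * ϖ ^ (m + k) := by ring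
    _ = _ := by rw [Units.inv_mul, mul_one]

lemma mem_localRing_iff (hX : IsRegularProjectiveCurve p) {x : X} (hx : x ≠ genericPoint X)
    {a : X.functionField} : a ∈ localRing x ↔ 0 ≤ Scheme.ord a x := by
  refine ⟨ord_nonneg_of_mem hX hx, fun h => ?_⟩
  have := isDiscreteValuationRing_stalk hX hx
  by_cases ha : a = 0
  · rw [ha]; exact zero_mem _
  obtain ⟨ϖ, hϖ⟩ := IsDiscreteValuationRing.exists_irreducible (X.presheaf.stalk x)
  obtain ⟨u, -, hu⟩ := exists_eq_of_ord_nonneg hX hx hϖ ha h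
  exact ⟨_, hu⟩

lemma mem_localUnits_iff (hX : IsRegularProjectiveCurve p) {x : X} (hx : x ≠ genericPoint X)
    {φ : RatUnits X} : φ ∈ localUnits X x ↔ Scheme.ord φ.val x = 0 := by
  refine ⟨ord_eq_zero_of_mem_localUnits, fun h => ?_⟩
  have := isDiscreteValuationRing_stalk hX hx
  obtain ⟨ϖ, hϖ⟩ := IsDiscreteValuationRing.exists_irreducible (X.presheaf.stalk x)
  obtain ⟨u, hu, h'⟩ := exists_eq_of_ord_nonneg hX hx hϖ φ.val_ne_zero h.ge
  rw [h] at h'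
  exact mem_localUnits.mpr ⟨hu.unit, by simpa using h'⟩

omit [IsLocallyNoetherian X] in
lemma mem_localUnits_genericPoint (φ : RatUnits X) : φ ∈ localUnits X (genericPoint X) :=
  mem_localUnits.mpr ⟨φ, algebraMap_genericPoint φ.val⟩

lemma ord_add_le (hX : IsRegularProjectiveCurve p) {x : X} (hx : x ≠ genericPoint X)
    {a b : X.functionField} (hab : a + b ≠ 0) :
    min (Scheme.ord a x) (Scheme.ord b x) ≤ Scheme.ord (a + b) x := by
  have := isDiscreteValuationRing_stalk hX hx
  exact Scheme.ord_add hab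

omit [IsLocallyNoetherian X] in
/-- A nonzero element of the function field, as an element of `Rat(X)ˣ`. -/
noncomputable def RatUnits.mk (a : X.functionField) (ha : a ≠ 0) : RatUnits X := Units.mk0 a ha

lemma exists_ord_eq_one (hX : IsRegularProjectiveCurve p) {x : X} (hx : x ≠ genericPoint X) :
    ∃ φ : RatUnits X, Scheme.ord φ.val x = 1 := by
  have := isDiscreteValuationRing_stalk hX hx
  obtain ⟨ϖ, hϖ⟩ := IsDiscreteValuationRing.exists_irreducible (X.presheaf.stalk x)
  refine ⟨.mk (algebraMap _ _ ϖ) ?_, ord_of_irreducible hX hx hϖ⟩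
  rw [ne_eq, map_eq_zero_iff _ (algebraMap_stalk_injective x)]
  exact hϖ.ne_zero

lemma finite_not_mem_localUnits (hX : IsRegularProjectiveCurve p) (φ : RatUnits X) :
    {x | φ ∉ localUnits X x}.Finite := by
  obtain ⟨U, s, hU, hs, hb⟩ := exists_unit_section φ
  refine (finite_compl_of_nonempty hX hU).subset fun x hx hxU => hx ?_
  have hu : IsUnit (X.presheaf.germ U x hxU s) := by
    rw [← Scheme.mem_basicOpen, hb]; exact hxU
  exact mem_localUnits.mpr ⟨hu.unit, hs x hxU⟩

lemma finite_ord_ne_zero (hX : IsRegularProjectiveCurve p) (φ : RatUnits X) :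
    {x | Scheme.ord φ.val x ≠ 0}.Finite :=
  (finite_not_mem_localUnits hX φ).subset fun _ hx h => hx (ord_eq_zero_of_mem_localUnits h)

/-! ### Scalars -/

omit [IsLocallyNoetherian X] in
lemma algebraMap_stalkScalar (x : X) (c : K) :
    algebraMap (X.presheaf.stalk x) X.functionField (stalkScalar p x c) =
      stalkScalar p (genericPoint X) c :=
  algebraMap_stalk_eq x ⊤ trivial trivial _

end Order
end TrivialArakelov

namespace TrivialArakelov

noncomputable section

open BerkovichSpace

/-! ## Points of the Berkovich space over the generic point -/

section GenericAbs

variable {K : Type u} [Field K] {X : Scheme.{u}} [IsIntegral X]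

/-- An absolute value on the function field of `X` which is trivial on `K`. -/
structure GenericAbs (p : X ⟶ Spec (.of K)) where
  abv : AbsoluteValue X.functionField ℝ
  abv_scalar : ∀ c : K, c ≠ 0 → abv (stalkScalar p (genericPoint X) c) = 1

variable {p : X ⟶ Spec (.of K)}

namespace GenericAbs

/-- The isomorphism from the residue field at the generic point to the function field. -/
def residueLift (X : Scheme.{u}) [IsIntegral X] :
    X.residueField (genericPoint X) →+* X.functionField :=
  IsLocalRing.ResidueField.lift (R := X.presheaf.stalk (genericPoint X)) (S := X.functionField)
    (RingHom.id _)

/-- The point of `X^an` over the generic point of `X` defined by an absolute value. -/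
def toBerkovich (v : GenericAbs p) : BerkovichSpace p where
  pt := genericPoint X
  abv := v.abv.comp (residueLift X).injective
  abv_scalar c hc := v.abv_scalar c hc

lemma absRat_toBerkovich (v : GenericAbs p) (φ : X.functionField) :
    absRat φ v.toBerkovich = v.abv φ :=
  absRat_eq (ξ := v.toBerkovich) (a := φ) (algebraMap_genericPoint φ)

lemma absSection_toBerkovich (v : GenericAbs p) (U : X.Opens) (h : v.toBerkovich.pt ∈ U)
    (s : Γ(X, U)) :
    v.toBerkovich.absSection U h s = v.abv (X.presheaf.germ U (genericPoint X) h s) := rfl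

lemma eq_toBerkovich {ξ : BerkovichSpace p} (h : ξ.pt = genericPoint X) (v : GenericAbs p)
    (hv : ∀ φ : X.functionField, absRat φ ξ = v.abv φ) : ξ = v.toBerkovich := by
  obtain ⟨x, w, hw⟩ := ξ
  subst h
  unfold toBerkovich
  congr 1
  ext a
  obtain ⟨b, rfl⟩ := X.residue_surjective _ a
  refine Eq.trans ?_ (hv b)
  exact (absRat_eq (ξ := ⟨genericPoint X, w, hw⟩) (a := b) (algebraMap_genericPoint b)).symm

lemma exists_eq_toBerkovich {ξ : BerkovichSpace p} (h : ξ.pt = genericPoint X) :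
    ∃ v : GenericAbs p, ξ = v.toBerkovich := by
  obtain ⟨x, w, hw⟩ := ξ
  subst h
  let r : X.functionField →+* X.residueField (genericPoint X) := (X.residue (genericPoint X)).hom
  let v : GenericAbs p := ⟨w.comp r.injective, hw⟩
  refine ⟨v, eq_toBerkovich rfl v fun φ => ?_⟩
  exact absRat_eq (ξ := ⟨genericPoint X, w, hw⟩) (a := φ) (algebraMap_genericPoint φ)

/-- Every non-empty Zariski open set contains the generic point. This is what gives a germ a value
at each point above it. -/
lemma tendsto_pure (v : GenericAbs p) : pure v.toBerkovich ≤ generic p := by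
  rintro S ⟨U, hU, h⟩
  exact h (mem_genericPoint hU : genericPoint X ∈ U)

/-- Evaluation of germs at the point defined by an absolute value. -/
def eval (v : GenericAbs p) : GenericFunction p →ₗ[ℝ] ℝ where
  toFun γ := γ.1.liftOn (fun h => h v.toBerkovich)
    (fun _ _ h => mem_pure.mp (v.tendsto_pure h))
  map_add' := by
    rintro ⟨γ, hγ⟩ ⟨δ, hδ⟩
    induction γ using Filter.Germ.inductionOn
    induction δ using Filter.Germ.inductionOn
    rfl
  map_smul' := by
    rintro c ⟨γ, hγ⟩
    induction γ using Filter.Germ.inductionOn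
    rfl

lemma eval_eq (v : GenericAbs p) {γ : GenericFunction p} {h : BerkovichSpace p → ℝ}
    (e : γ.1 = (h : Germ (generic p) ℝ)) : v.eval γ = h v.toBerkovich := by
  obtain ⟨γ, hγ⟩ := γ
  change γ = _ at e
  subst e
  rfl

lemma abv_pos (v : GenericAbs p) (φ : RatUnits X) : 0 < v.abv φ.val :=
  v.abv.pos φ.val_ne_zero

/-- The homomorphism `φ ↦ log |φ|` on `Rat(X)ˣ`. -/
def logInt (v : GenericAbs p) : Additive (RatUnits X) →+ ℝ :=
  AddMonoidHom.mk' (fun φ => Real.log (v.abv φ.toMul.val)) fun φ ψ => by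
    change Real.log (v.abv (RatUnits.val (φ.toMul * ψ.toMul))) = _
    rw [map_mul, map_mul, Real.log_mul (v.abv_pos _).ne' (v.abv_pos _).ne']

/-- The real linear extension of `φ ↦ log |φ|`. -/
def log (v : GenericAbs p) : RealRat X →ₗ[ℝ] ℝ := v.logInt.toIntLinearMap.liftBaseChange ℝ

lemma log_tmul (v : GenericAbs p) (a : ℝ) (φ : RatUnits X) :
    v.log (a ⊗ₜ Additive.ofMul φ) = a * Real.log (v.abv φ.val) :=
  LinearMap.liftBaseChange_tmul _ _ _ _

lemma eval_logAbs (v : GenericAbs p) (φ : RealRat X) : v.eval (logAbs p φ) = v.log φ := by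
  suffices v.eval ∘ₗ logAbs p = v.log from LinearMap.congr_fun this φ
  ext φ
  obtain ⟨φ, rfl⟩ := Additive.ofMul.surjective φ
  have e : logAbs p (1 ⊗ₜ Additive.ofMul φ) = logAbsInt p (Additive.ofMul φ) := by
    simp [logAbs]
  change v.eval (logAbs p (1 ⊗ₜ Additive.ofMul φ)) = v.log (1 ⊗ₜ Additive.ofMul φ)
  rw [e, log_tmul, one_mul]
  change Real.log (absRat φ.val v.toBerkovich) = _
  rw [absRat_toBerkovich]

/-! ### Centers, and logarithms of local equations -/

/-- The absolute value is bounded by one on the local ring at `x`. -/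
def IsCenter (v : GenericAbs p) (x : X) : Prop := ∀ a ∈ localRing x, v.abv a ≤ 1

/-- A unit and its inverse are both bounded by one. A center is not asked to be dominated by `v`, so
that the trivial absolute value has every point as a center. -/
lemma IsCenter.abv_eq_one {v : GenericAbs p} {x : X} (h : v.IsCenter x) {φ : RatUnits X}
    (hφ : φ ∈ localUnits X x) : v.abv φ.val = 1 := by
  obtain ⟨u, hu⟩ := mem_localUnits.mp hφ
  obtain ⟨w, hw⟩ := mem_localUnits.mp (inv_mem hφ)
  refine le_antisymm (h _ ⟨u, hu⟩) ?_
  have h1 := h _ ⟨w, hw⟩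
  have h2 : v.abv (φ⁻¹).val * v.abv φ.val = 1 := by
    rw [← map_mul, ← map_mul, inv_mul_cancel, map_one, map_one]
  nlinarith [v.abv_pos φ]

/-- The logarithm of the absolute value of a local equation at a center. -/
def germLog (v : GenericAbs p) (x : X) (h : v.IsCenter x) : DivisorGerm X x →+ ℝ :=
  MonoidHom.toAdditiveLeft (QuotientGroup.lift (localUnits X x)
    (AddMonoidHom.toMultiplicativeRight v.logInt) (fun φ hφ => by
      change Multiplicative.ofAdd (Real.log (v.abv φ.val)) = 1
      rw [h.abv_eq_one hφ, Real.log_one]; rfl))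

lemma germLog_toGerm (v : GenericAbs p) (x : X) (h : v.IsCenter x) (φ : Additive (RatUnits X)) :
    v.germLog x h (toGerm X x φ) = v.logInt φ := rfl

/-- The real linear extension of `germLog` to real divisors. -/
def divLog (v : GenericAbs p) (x : X) (h : v.IsCenter x) : RealDivisor X →ₗ[ℝ] ℝ :=
  (v.germLog x h).toIntLinearMap.liftBaseChange ℝ ∘ₗ realGerm x

lemma divLog_tmul (v : GenericAbs p) (x : X) (h : v.IsCenter x) (a : ℝ) (E : CartierDivisor X) :
    v.divLog x h (a ⊗ₜ E) = a * v.germLog x h (E.1 x) := by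
  simp [divLog, realGerm]

lemma divLog_eq_log (v : GenericAbs p) (x : X) (h : v.IsCenter x) {D : RealDivisor X}
    {ψ : RealRat X} (e : realGerm x D = (toGerm X x).toIntLinearMap.baseChange ℝ ψ) :
    v.divLog x h D = v.log ψ := by
  rw [divLog, LinearMap.comp_apply, e, ← LinearMap.comp_apply]
  congr 1
  ext φ
  simp [log, germLog_toGerm]

lemma realGerm_principalDivisor (x : X) (s : RealRat X) :
    realGerm x (principalDivisor X s) = (toGerm X x).toIntLinearMap.baseChange ℝ s := by
  rw [← LinearMap.comp_apply]
  congr 1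
  ext φ
  simp [realGerm, principalDivisor, principalInt]

lemma divLog_principalDivisor (v : GenericAbs p) (x : X) (h : v.IsCenter x) (s : RealRat X) :
    v.divLog x h (principalDivisor X s) = v.log s :=
  v.divLog_eq_log x h (realGerm_principalDivisor x s)

/-! ### Functoriality -/

lemma absRat_map_toBerkovich (v : GenericAbs p) (f : X ⟶ X) [Surjective f] (hf : f ≫ p = p)
    (φ : X.functionField) :
    absRat φ (BerkovichSpace.map f hf v.toBerkovich) = v.abv (ratPullback f φ) := by
  have hfη : f (genericPoint X) = genericPoint X := by
    refine (Specializes.antisymm (specializes_genericPoint f) ?_).eq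
    exact (genericPoint_spec X).specializes (Set.mem_univ _)
  obtain ⟨a, rfl⟩ : ∃ a : X.presheaf.stalk (f (genericPoint X)),
      algebraMap (X.presheaf.stalk (f (genericPoint X))) X.functionField a = φ := by
    rw [hfη]
    exact ⟨φ, algebraMap_genericPoint φ⟩
  rw [ratPullback_algebraMap, algebraMap_genericPoint]
  exact absRat_eq (ξ := BerkovichSpace.map f hf v.toBerkovich) (a := a) rfl

/-- The pull-back of an absolute value along `f^* : Rat(X) → Rat(X)`. -/
def pullback (v : GenericAbs p) (f : X ⟶ X) [Surjective f] (hf : f ≫ p = p) : GenericAbs p where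
  abv := v.abv.comp (ratPullback f).injective
  abv_scalar c hc := by
    change v.abv (ratPullback f _) = 1
    rw [← absRat_map_toBerkovich v f hf]
    rw [absRat_eq (ξ := BerkovichSpace.map f hf v.toBerkovich) (algebraMap_stalkScalar _ c)]
    exact (BerkovichSpace.map f hf v.toBerkovich).abv_scalar c hc

lemma pullback_abv (v : GenericAbs p) (f : X ⟶ X) [Surjective f] (hf : f ≫ p = p)
    (a : X.functionField) : (v.pullback f hf).abv a = v.abv (ratPullback f a) := rfl

lemma map_toBerkovich (v : GenericAbs p) (f : X ⟶ X) [Surjective f] (hf : f ≫ p = p) :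
    BerkovichSpace.map f hf v.toBerkovich = (v.pullback f hf).toBerkovich := by
  refine eq_toBerkovich ?_ _ fun φ => absRat_map_toBerkovich v f hf φ
  refine (Specializes.antisymm (specializes_genericPoint f) ?_).eq
  exact (genericPoint_spec X).specializes (Set.mem_univ _)

lemma eval_genericPullback (v : GenericAbs p) (f : X ⟶ X) [Surjective f] (hf : f ≫ p = p)
    (γ : GenericFunction p) :
    v.eval (genericPullback f hf γ) = (v.pullback f hf).eval γ := by
  obtain ⟨γ, hγ⟩ := γ
  induction γ using Filter.Germ.inductionOn with
  | h γ =>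
    change γ (BerkovichSpace.map f hf v.toBerkovich) = γ (v.pullback f hf).toBerkovich
    rw [map_toBerkovich]

lemma IsCenter.pullback {v : GenericAbs p} {x : X} (h : v.IsCenter x) (f : X ⟶ X) [Surjective f]
    (hf : f ≫ p = p) : (v.pullback f hf).IsCenter (f x) := by
  rintro _ ⟨a, rfl⟩
  rw [pullback_abv, ratPullback_algebraMap]
  exact h _ ⟨_, rfl⟩

lemma divLog_divisorPullback (v : GenericAbs p) {x : X} (h : v.IsCenter x) (f : X ⟶ X)
    [Surjective f] (hf : f ≫ p = p) (D : RealDivisor X) :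
    v.divLog x h (divisorPullback f D) = (v.pullback f hf).divLog (f x) (h.pullback f hf) D := by
  suffices v.divLog x h ∘ₗ divisorPullback f = (v.pullback f hf).divLog (f x) (h.pullback f hf) from
    LinearMap.congr_fun this D
  ext E
  change v.divLog x h (1 ⊗ₜ divisorPullbackInt f E) =
    (v.pullback f hf).divLog (f x) (h.pullback f hf) (1 ⊗ₜ E)
  rw [divLog_tmul, divLog_tmul]
  congr 1
  change v.germLog x h (germPullback f x (E.1 (f x))) = _
  generalize E.1 (f x) = γ
  obtain ⟨φ, rfl⟩ : ∃ φ, toGerm X (f x) φ = γ := QuotientGroup.mk'_surjective _ γ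
  rw [germPullback_toGerm, germLog_toGerm, germLog_toGerm]
  rfl

/-- The defect between a Green function and the logarithm of local equations is multiplied by `d`
by a dynamical system. -/
lemma defect_pullback (v : GenericAbs p) {x : X} (h : v.IsCenter x) (f : X ⟶ X)
    [Surjective f] (hf : f ≫ p = p) {D : RealDivisor X} {g : GenericFunction p} {d : ℝ}
    {φ : RealRat X} (hD : divisorPullback f D = d • D + principalDivisor X φ)
    (hg : genericPullback f hf g = d • g - logAbs p φ) :
    (v.pullback f hf).eval g + (v.pullback f hf).divLog (f x) (h.pullback f hf) D =
      d * (v.eval g + v.divLog x h D) := by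
  rw [← eval_genericPullback, hg, ← divLog_divisorPullback v h f hf, hD]
  simp only [map_sub, map_add, map_smul, smul_eq_mul, eval_logAbs, divLog_principalDivisor]
  ring

/-- A Green function which is multiplied by `d > 1` differs from the logarithm of the local
equations by zero, once the difference is bounded. -/
lemma eval_add_divLog_eq_zero (f : X ⟶ X)
    [Surjective f] (hf : f ≫ p = p) {D : RealDivisor X} {g : GenericFunction p} {d : ℝ} (hd : 1 < d)
    {φ : RealRat X} (hD : divisorPullback f D = d • D + principalDivisor X φ)
    (hg : genericPullback f hf g = d • g - logAbs p φ) {C : ℝ}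
    (hC : ∀ (v : GenericAbs p) (x : X) (h : v.IsCenter x), |v.eval g + v.divLog x h D| ≤ C)
    (v : GenericAbs p) (x : X) (h : v.IsCenter x) : v.eval g + v.divLog x h D = 0 := by
  -- The `n`-th iterate of `f` sends `v` to an absolute value whose defect is `d ^ n` times larger,
  -- and the same bound `C` applies to it.
  have key : ∀ n : ℕ, ∀ (v : GenericAbs p) (x : X) (h : v.IsCenter x),
      d ^ n * |v.eval g + v.divLog x h D| ≤ C := by
    intro n
    induction n with
    | zero => intro v x h; simpa using hC v x h
    | succ n ih =>
      intro v x h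
      have := ih _ _ (h.pullback f hf)
      rw [defect_pullback v h f hf hD hg, abs_mul, abs_of_pos (by linarith : 0 < d)] at this
      rw [pow_succ]; linarith
  by_contra hne
  have hpos := abs_pos.mpr hne
  obtain ⟨n, hn⟩ := pow_unbounded_of_one_lt (C / |v.eval g + v.divLog x h D|) hd
  rw [div_lt_iff₀ hpos] at hn
  exact absurd (key n v x h) (not_le.mpr hn)

end GenericAbs
end GenericAbs
end
end TrivialArakelov

namespace TrivialArakelov

noncomputable section

open BerkovichSpace

/-! ## The branches of the Berkovich space of a curve -/

section Rays

variable {K : Type u} [Field K] {X : Scheme.{u}} [IsIntegral X]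
  {p : X ⟶ Spec (.of K)}

/-- An absolute value on a finite extension of a trivially valued field is trivial. -/
lemma absoluteValue_eq_one_of_finite {L : Type*} [Field L] {i : K →+* L} (hi : i.Finite)
    (w : AbsoluteValue L ℝ) (hw : ∀ c : K, c ≠ 0 → w (i c) = 1) {a : L} (ha : a ≠ 0) :
    w a = 1 := by
  let := i.toAlgebra
  have : Module.Finite K L := hi
  let b := Module.finBasis K L
  -- In a basis over `K` all non-zero coordinates have absolute value one, so `w` is bounded on `L`.
  -- Being bounded on the powers of an element, it is at most one on it, and likewise on its
  -- inverse.
  have hC (y : L) : w y ≤ ∑ j, w (b j) := by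
    conv_lhs => rw [← b.sum_repr y]
    refine (w.sum_le _ _).trans (Finset.sum_le_sum fun j _ => ?_)
    rw [Algebra.smul_def, map_mul]
    by_cases hc : b.repr y j = 0
    · simp [hc]
    · exact ((congrArg (· * _) (hw _ hc)).trans (one_mul _)).le
  have key (y : L) : w y ≤ 1 := by
    by_contra! h
    obtain ⟨n, hn⟩ := pow_unbounded_of_one_lt (∑ j, w (b j)) h
    exact absurd (hC (y ^ n)) (by rw [map_pow]; exact not_le.mpr hn)
  refine le_antisymm (key a) ?_
  have h1 := key a⁻¹
  have h2 : w a⁻¹ * w a = 1 := by rw [← map_mul, inv_mul_cancel₀ ha, map_one]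
  nlinarith [w.pos ha]

lemma BerkovichSpace.abv_eq_one (hX : IsRegularProjectiveCurve p) {ξ : BerkovichSpace p}
    (h : ξ.pt ≠ genericPoint X) {a : X.residueField ξ.pt} (ha : a ≠ 0) : ξ.abv a = 1 :=
  absoluteValue_eq_one_of_finite (finite_residueField hX h) ξ.abv ξ.abv_scalar ha

open Classical in
/-- The point of `X^an` defined by the trivial absolute value on the residue field at `x`. -/
def trivialPoint (p : X ⟶ Spec (.of K)) (x : X) : BerkovichSpace p where
  pt := x
  abv := AbsoluteValue.trivial
  abv_scalar c hc := by
    rw [AbsoluteValue.trivial_apply]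
    rwa [ne_eq, map_eq_zero]

-- The fibre of `X^an` over a closed point is a single point, because the residue field is finite
-- over `K`.
open Classical in
lemma eq_trivialPoint (hX : IsRegularProjectiveCurve p) {ξ : BerkovichSpace p}
    (h : ξ.pt ≠ genericPoint X) : ξ = trivialPoint p ξ.pt := by
  have := @BerkovichSpace.abv_eq_one _ _ _ _ _ hX ξ h
  obtain ⟨x, w, hw⟩ := ξ
  unfold trivialPoint
  congr 1
  ext a
  by_cases ha : a = 0
  · simp [ha]
  · rw [AbsoluteValue.trivial_apply ha]
    exact this ha

namespace GenericAbs

open Classical in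
/-- The trivial absolute value on the function field. -/
def trivialAbs (p : X ⟶ Spec (.of K)) : GenericAbs p where
  abv := AbsoluteValue.trivial
  abv_scalar c hc := by
    rw [AbsoluteValue.trivial_apply]
    rwa [ne_eq, map_eq_zero]

@[ext]
lemma ext {v w : GenericAbs p} (h : ∀ φ : RatUnits X, v.abv φ.val = w.abv φ.val) : v = w := by
  obtain ⟨v, hv⟩ := v
  obtain ⟨w, hw⟩ := w
  congr 1
  ext a
  by_cases ha : a = 0
  · simp [ha]
  · exact h (.mk a ha)

open Classical in
lemma eq_trivialAbs {v : GenericAbs p} (h : v.IsCenter (genericPoint X)) : v = trivialAbs p := by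
  ext φ
  rw [h.abv_eq_one (mem_localUnits_genericPoint φ)]
  exact (AbsoluteValue.trivial_apply φ.val_ne_zero).symm

variable [IsLocallyNoetherian X]

open Classical in
/-- The absolute value `r ^ ord_x` on the function field. -/
def ray (hX : IsRegularProjectiveCurve p) {x : X} (hx : x ≠ genericPoint X) (r : ℝ) (h0 : 0 < r)
    (h1 : r ≤ 1) : GenericAbs p where
  abv :=
    { toFun := fun a => if a = 0 then 0 else r ^ Scheme.ord a x
      map_mul' := fun a b => by
        by_cases ha : a = 0
        · simp [ha]
        by_cases hb : b = 0
        · simp [hb]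
        simp [ha, hb, Scheme.ord_mul, zpow_add₀ h0.ne']
      nonneg' := fun a => by
        split_ifs
        · exact le_rfl
        · exact (zpow_pos h0 _).le
      eq_zero' := fun a => by
        have := (zpow_pos h0 (Scheme.ord a x)).ne'
        simp [this]
      add_le' := fun a b => by
        by_cases ha : a = 0
        · simp [ha]
        by_cases hb : b = 0
        · simp [hb]
        have ha' := zpow_pos h0 (Scheme.ord a x)
        have hb' := zpow_pos h0 (Scheme.ord b x)
        by_cases hab : a + b = 0
        · simp [ha, hb, hab]; positivity
        simp only [ha, hb, hab, if_false]
        rcases min_le_iff.mp (ord_add_le hX hx hab) with h | h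
        · exact (zpow_le_zpow_right_of_le_one₀ h0 h1 h).trans (by linarith)
        · exact (zpow_le_zpow_right_of_le_one₀ h0 h1 h).trans (by linarith) }
  abv_scalar c hc := by
    have hc' : stalkScalar p (genericPoint X) c ≠ 0 :=
      (map_ne_zero (f := (stalkScalar p (genericPoint X) : K →+* X.functionField))).mpr hc
    have hu : IsUnit (stalkScalar p x c) := (IsUnit.mk0 c hc).map _
    have := ord_of_isUnit hu
    rw [algebraMap_stalkScalar] at this
    change (if _ then _ else _) = _
    rw [if_neg hc', this, zpow_zero]

lemma ray_apply (hX : IsRegularProjectiveCurve p) {x : X} (hx : x ≠ genericPoint X) {r : ℝ}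
    (h0 : 0 < r) (h1 : r ≤ 1) {a : X.functionField} (ha : a ≠ 0) :
    (ray hX hx r h0 h1).abv a = r ^ Scheme.ord a x := if_neg ha

/-- The parameter is `r = |ϖ|` for a uniformizer `ϖ`: dividing `φ` by `ϖ ^ ord φ` leaves a unit at
`x`, of absolute value one. -/
lemma IsCenter.exists_eq_ray (hX : IsRegularProjectiveCurve p) {x : X} (hx : x ≠ genericPoint X)
    {v : GenericAbs p} (h : v.IsCenter x) :
    ∃ (r : ℝ) (h0 : 0 < r) (h1 : r ≤ 1), v = ray hX hx r h0 h1 := by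
  obtain ⟨ϖ, hϖ⟩ := exists_ord_eq_one hX hx
  have h0 := v.abv_pos ϖ
  refine ⟨v.abv ϖ.val, h0, h _ ((mem_localRing_iff hX hx).mpr (by omega)), ?_⟩
  ext φ
  rw [ray_apply _ _ _ _ φ.val_ne_zero]
  have hm : φ * (ϖ ^ Scheme.ord φ.val x)⁻¹ ∈ localUnits X x := by
    rw [mem_localUnits_iff hX hx]
    have h2 := congrArg Multiplicative.toAdd (map_zpow (ordUnits x) ϖ (Scheme.ord φ.val x))
    have h3 := congrArg Multiplicative.toAdd
      (map_mul (ordUnits x) φ (ϖ ^ Scheme.ord φ.val x)⁻¹)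
    rw [map_inv, toAdd_mul, toAdd_inv, h2, toAdd_zpow] at h3
    change Scheme.ord _ x = Scheme.ord φ.val x - _ at h3
    rw [h3]
    change _ - _ • Scheme.ord ϖ.val x = 0
    rw [hϖ]; simp
  have h4 := h.abv_eq_one hm
  have h5 : (φ * (ϖ ^ Scheme.ord φ.val x)⁻¹).val = φ.val * (ϖ.val ^ Scheme.ord φ.val x)⁻¹ := by
    rw [map_mul]
    congr 1
    exact (Units.val_inv_eq_inv_val (α := X.functionField) _).trans
      (congrArg _ (Units.val_zpow_eq_zpow_val (α := X.functionField) _ _))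
  rw [h5, map_mul, map_inv₀, map_zpow₀] at h4
  exact eq_of_mul_inv_eq_one h4

-- A neighbourhood of the trivial absolute value contains all but finitely many branches entirely.
-- With the compactness of each branch, this replaces the compactness of `X^an`. It holds because a
-- non-zero section is a unit at all but finitely many points, and has absolute value one for every
-- `v` centered at such a point.
open Classical in
lemma exists_finite_notMem (hX : IsRegularProjectiveCurve p) {S : Set (BerkovichSpace p)}
    (hS : S ∈ 𝓝 (trivialAbs p).toBerkovich) :
    ∃ B : Set X, B.Finite ∧ ∀ (v : GenericAbs p) (x : X), v.IsCenter x → x ∉ B →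
      v.toBerkovich ∈ S := by
  -- Stated as convergence of centered absolute values along cofinitely many centers, the claim
  -- needs checking on subbasic open sets only.
  let P := {q : GenericAbs p × X // q.1.IsCenter q.2}
  have key : Tendsto (fun q : P => q.1.1.toBerkovich) (comap (fun q : P => q.1.2) cofinite)
      (𝓝 (trivialAbs p).toBerkovich) := by
    rw [tendsto_nhds_generateFrom_iff]
    rintro S (⟨U, rfl⟩ | ⟨U, s, V, hV, rfl⟩) hη
    · exact univ_mem' fun q => hη
    obtain ⟨hU, hs⟩ := hη
    rw [absSection_toBerkovich] at hs
    by_cases h0 : X.presheaf.germ U (genericPoint X) hU s = 0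
    · refine univ_mem' fun q => ⟨hU, ?_⟩
      change q.1.1.abv (X.presheaf.germ U (genericPoint X) hU s) ∈ V
      rw [h0, map_zero]
      rwa [h0, map_zero] at hs
    let φ : RatUnits X := .mk (X.presheaf.germ U (genericPoint X) hU s) h0
    refine mem_comap.mpr ⟨_, (finite_not_mem_localUnits hX φ).compl_mem_cofinite, fun q hq => ?_⟩
    refine ⟨hU, ?_⟩
    have h1 : q.1.1.abv φ.val = 1 := q.2.abv_eq_one (not_not.mp hq)
    have h2 : (trivialAbs p).abv φ.val = 1 := AbsoluteValue.trivial_apply φ.val_ne_zero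
    change q.1.1.abv φ.val ∈ V
    rw [h1, ← h2]
    exact hs
  obtain ⟨t, ht, hts⟩ := mem_comap.mp (key hS)
  exact ⟨tᶜ, ht, fun v x h hx => hts (a := ⟨(v, x), h⟩) (not_not.mp hx)⟩

end GenericAbs

variable [IsLocallyNoetherian X]

/-! ### Closed branches and their continuity -/

open Classical in
/-- The branch of `X^an` at a closed point `x`, with the point `(x, trivial)` for `r ≤ 0`. -/
def branch (hX : IsRegularProjectiveCurve p) {x : X} (hx : x ≠ genericPoint X) (r : ℝ) :
    BerkovichSpace p :=
  if h : 0 < r then (GenericAbs.ray hX hx (min r 1) (lt_min h one_pos) (min_le_right _ _)).toBerkovich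
  else trivialPoint p x

lemma branch_of_pos (hX : IsRegularProjectiveCurve p) {x : X} (hx : x ≠ genericPoint X) {r : ℝ}
    (h : 0 < r) : branch hX hx r =
      (GenericAbs.ray hX hx (min r 1) (lt_min h one_pos) (min_le_right _ _)).toBerkovich :=
  dif_pos h

lemma branch_of_nonpos (hX : IsRegularProjectiveCurve p) {x : X} (hx : x ≠ genericPoint X) {r : ℝ}
    (h : r ≤ 0) : branch hX hx r = trivialPoint p x :=
  dif_neg (not_lt.mpr h)

lemma branch_mem_zariskiOpen (hX : IsRegularProjectiveCurve p) {x : X} (hx : x ≠ genericPoint X)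
    {U : X.Opens} (hxU : x ∈ U) (r : ℝ) : branch hX hx r ∈ zariskiOpen p U := by
  rcases le_or_gt r 0 with h | h
  · rw [branch_of_nonpos hX hx h]; exact hxU
  · rw [branch_of_pos hX hx h]; exact mem_genericPoint ⟨x, hxU⟩

lemma branch_mem_zariskiOpen_of_notMem (hX : IsRegularProjectiveCurve p) {x : X}
    (hx : x ≠ genericPoint X) {U : X.Opens} (hxU : x ∉ U) (hU : genericPoint X ∈ U) (r : ℝ) :
    branch hX hx r ∈ zariskiOpen p U ↔ 0 < r := by
  rcases le_or_gt r 0 with h | h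
  · rw [branch_of_nonpos hX hx h]; exact iff_of_false hxU (not_lt.mpr h)
  · rw [branch_of_pos hX hx h]; exact iff_of_true hU h

lemma absSection_branch_of_pos (hX : IsRegularProjectiveCurve p) {x : X} (hx : x ≠ genericPoint X)
    {U : X.Opens} {s : Γ(X, U)} (hU : genericPoint X ∈ U)
    (hs : X.presheaf.germ U (genericPoint X) hU s ≠ 0) {r : ℝ} (h : 0 < r)
    (h' : (branch hX hx r).pt ∈ U) :
    (branch hX hx r).absSection U h' s =
      (min r 1) ^ Scheme.ord (X.presheaf.germ U (genericPoint X) hU s : X.functionField) x := by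
  revert h'
  rw [branch_of_pos hX hx h]
  intro h'
  rw [GenericAbs.absSection_toBerkovich]
  exact GenericAbs.ray_apply hX hx _ _ hs

-- The exponent records vanishing: by `0 ^ 0 = 1` the value is one if `s` is a unit at `x`, and zero
-- otherwise. It is the value at `r = 0` of the formula `r ^ ord` on the branch.
open Classical in
lemma absSection_trivialPoint (hX : IsRegularProjectiveCurve p) {x : X} (hx : x ≠ genericPoint X)
    {U : X.Opens} {s : Γ(X, U)} (hxU : x ∈ U) (hU : genericPoint X ∈ U)
    (hs : X.presheaf.germ U (genericPoint X) hU s ≠ 0) :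
    (trivialPoint p x).absSection U hxU s =
      0 ^ (Scheme.ord (X.presheaf.germ U (genericPoint X) hU s : X.functionField) x).toNat := by
  let φ : RatUnits X := .mk (X.presheaf.germ U (genericPoint X) hU s) hs
  have hφ : algebraMap (X.presheaf.stalk x) X.functionField (X.presheaf.germ U x hxU s) = φ.val :=
    algebraMap_stalk_eq x U hxU hU s
  have hnn : 0 ≤ Scheme.ord φ.val x := ord_nonneg_of_mem hX hx ⟨_, hφ⟩
  change (trivialPoint p x).abv (X.residue x (X.presheaf.germ U x hxU s)) =
    0 ^ (Scheme.ord φ.val x).toNat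
  by_cases hu : IsUnit (X.presheaf.germ U x hxU s)
  · have h0 : X.residue x (X.presheaf.germ U x hxU s) ≠ 0 := (hu.map (X.residue x).hom).ne_zero
    have h1 := ord_of_isUnit hu
    rw [hφ] at h1
    rw [h1]
    exact (AbsoluteValue.trivial_apply h0).trans (pow_zero _).symm
  · have h0 : X.residue x (X.presheaf.germ U x hxU s) = 0 :=
      Ideal.Quotient.eq_zero_iff_mem.mpr ((IsLocalRing.mem_maximalIdeal _).mpr hu)
    have h1 : Scheme.ord φ.val x ≠ 0 := fun h1 => by
      obtain ⟨w, hw⟩ := mem_localUnits.mp ((mem_localUnits_iff hX hx).mpr h1)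
      exact hu (algebraMap_stalk_injective x (hw.trans hφ.symm) ▸ w.isUnit)
    rw [zero_pow (by omega)]
    refine (congrArg _ h0).trans (map_zero _)

lemma absSection_branch (hX : IsRegularProjectiveCurve p) {x : X} (hx : x ≠ genericPoint X)
    {U : X.Opens} {s : Γ(X, U)} (hxU : x ∈ U) (hU : genericPoint X ∈ U)
    (hs : X.presheaf.germ U (genericPoint X) hU s ≠ 0) (r : ℝ)
    (h' : (branch hX hx r).pt ∈ U) :
    (branch hX hx r).absSection U h' s = (max 0 (min r 1)) ^
      (Scheme.ord (X.presheaf.germ U (genericPoint X) hU s : X.functionField) x).toNat := by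
  rcases le_or_gt r 0 with h | h
  · have e : max 0 (min r 1) = 0 := max_eq_left ((min_le_left _ _).trans h)
    rw [e]
    revert h'
    rw [branch_of_nonpos hX hx h]
    intro h'
    exact absSection_trivialPoint hX hx hxU hU hs
  · have e : max 0 (min r 1) = min r 1 := max_eq_right (lt_min h one_pos).le
    rw [e, absSection_branch_of_pos hX hx hU hs h h', ← zpow_natCast, Int.toNat_of_nonneg]
    exact ord_nonneg_of_mem hX hx ⟨_, algebraMap_stalk_eq x U hxU hU s⟩

omit [IsLocallyNoetherian X] in
lemma absSection_branch_zero (ξ : BerkovichSpace p)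
    {U : X.Opens} {s : Γ(X, U)} (hU : genericPoint X ∈ U)
    (hs : X.presheaf.germ U (genericPoint X) hU s = 0) (h' : ξ.pt ∈ U) :
    ξ.absSection U h' s = 0 := by
  have : s = 0 := germ_injective_of_isIntegral X _ hU (hs.trans (map_zero _).symm)
  rw [absSection, this, map_zero, map_zero]

/-- Truncating the parameter to `[0, 1]` makes the branch a map on the whole line. If `x ∈ U`, the
order of `s` at `x` is non-negative and `|s|` is a monomial in the truncated parameter, also at the
end point. If `x ∉ U`, only `r > 0` lies over `U`, and there negative exponents are harmless. -/
lemma continuous_branch (hX : IsRegularProjectiveCurve p) {x : X} (hx : x ≠ genericPoint X) :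
    Continuous (branch hX hx) := by
  have hzar (U : X.Opens) : IsOpen (branch hX hx ⁻¹' zariskiOpen p U) := by
    by_cases hxU : x ∈ U
    · rw [show branch hX hx ⁻¹' zariskiOpen p U = Set.univ from
        Set.eq_univ_of_forall (branch_mem_zariskiOpen hX hx hxU)]
      exact isOpen_univ
    by_cases hU : genericPoint X ∈ U
    · rw [show branch hX hx ⁻¹' zariskiOpen p U = Set.Ioi 0 from
        Set.ext (branch_mem_zariskiOpen_of_notMem hX hx hxU hU)]
      exact isOpen_Ioi
    · rw [show branch hX hx ⁻¹' zariskiOpen p U = ∅ from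
        Set.eq_empty_of_forall_notMem fun r hr => hU (mem_genericPoint ⟨_, hr⟩)]
      exact isOpen_empty
  refine continuous_generateFrom_iff.mpr ?_
  rintro S (⟨U, rfl⟩ | ⟨U, s, V, hV, rfl⟩)
  · exact hzar U
  by_cases hU : genericPoint X ∈ U
  swap
  · convert isOpen_empty
    exact Set.eq_empty_of_forall_notMem fun r ⟨hr, _⟩ => hU (mem_genericPoint ⟨_, hr⟩)
  by_cases hs : X.presheaf.germ U (genericPoint X) hU s = 0
  · by_cases h0 : (0 : ℝ) ∈ V
    · convert hzar U
      ext ξ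
      refine ⟨fun h => h.1, fun h => ⟨h, ?_⟩⟩
      rwa [absSection_branch_zero ξ hU hs h]
    · convert isOpen_empty
      refine Set.eq_empty_of_forall_notMem fun r ⟨hr, h⟩ => h0 ?_
      rwa [absSection_branch_zero _ hU hs hr] at h
  by_cases hxU : x ∈ U
  · have hc : Continuous fun r : ℝ => (max 0 (min r 1)) ^
      (Scheme.ord (X.presheaf.germ U (genericPoint X) hU s : X.functionField) x).toNat := by
      fun_prop
    convert hV.preimage hc using 1
    ext r
    constructor
    · rintro ⟨hr, h⟩
      rwa [absSection_branch hX hx hxU hU hs r hr] at h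
    · intro h
      have hr : (branch hX hx r).pt ∈ U := branch_mem_zariskiOpen hX hx hxU r
      refine ⟨hr, ?_⟩
      rwa [absSection_branch hX hx hxU hU hs r hr]
  · have hc : ContinuousOn (fun r : ℝ => (min r 1) ^
      Scheme.ord (X.presheaf.germ U (genericPoint X) hU s : X.functionField) x) (Set.Ioi 0) := by
      refine ContinuousOn.zpow₀ (by fun_prop) _ fun r hr => Or.inl ?_
      exact (lt_min hr one_pos).ne'
    convert hc.isOpen_inter_preimage isOpen_Ioi hV using 1
    ext r
    constructor
    · rintro ⟨hr, h⟩
      have hr' := (branch_mem_zariskiOpen_of_notMem hX hx hxU hU r).mp hr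
      rw [absSection_branch_of_pos hX hx hU hs hr' hr] at h
      exact ⟨hr', h⟩
    · rintro ⟨hr, h⟩
      have hr' : (branch hX hx r).pt ∈ U :=
        (branch_mem_zariskiOpen_of_notMem hX hx hxU hU r).mpr hr
      refine ⟨hr', ?_⟩
      rwa [absSection_branch_of_pos hX hx hU hs hr hr']

lemma GenericAbs.IsCenter.exists_eq_branch (hX : IsRegularProjectiveCurve p) {x : X}
    (hx : x ≠ genericPoint X) {v : GenericAbs p} (h : v.IsCenter x) :
    ∃ r ∈ Set.Icc (0 : ℝ) 1, v.toBerkovich = branch hX hx r := by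
  obtain ⟨r, h0, h1, rfl⟩ := h.exists_eq_ray hX hx
  refine ⟨r, ⟨h0.le, h1⟩, ?_⟩
  rw [branch_of_pos hX hx h0]
  congr 2
  exact (min_eq_left h1).symm

/-- Points over the generic point are dense: continuous functions which agree on them agree. -/
lemma eqOn_of_eqOn_generic (hX : IsRegularProjectiveCurve p) {U : X.Opens}
    {h k : BerkovichSpace p → ℝ} (hh : ContinuousOn h (zariskiOpen p U))
    (hk : ContinuousOn k (zariskiOpen p U))
    (e : ∀ v : GenericAbs p, h v.toBerkovich = k v.toBerkovich) :
    Set.EqOn h k (zariskiOpen p U) := by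
  intro ξ hξ
  by_cases hη : ξ.pt = genericPoint X
  · obtain ⟨v, rfl⟩ := GenericAbs.exists_eq_toBerkovich hη
    exact e v
  -- A point over a closed point is the end of its branch, hence a limit for `r → 0` of points over
  -- the generic point.
  have hc := (continuous_branch hX hη).tendsto 0
  rw [branch_of_nonpos hX hη le_rfl, ← eq_trivialPoint hX hη] at hc
  have hU := (isOpen_zariskiOpen p U).mem_nhds hξ
  have h1 := ((hh.continuousAt hU).tendsto.comp hc).mono_left (nhdsWithin_le_nhds (s := Set.Ioi 0))
  have h2 := ((hk.continuousAt hU).tendsto.comp hc).mono_left (nhdsWithin_le_nhds (s := Set.Ioi 0))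
  refine tendsto_nhds_unique h1 (h2.congr' ?_)
  filter_upwards [self_mem_nhdsWithin] with r hr
  simp only [Function.comp_apply, branch_of_pos hX hη hr, e]

/-! ### Boundedness of the defect -/

omit [IsLocallyNoetherian X] in
lemma exists_isLocalEquation (D : RealDivisor X) (x : X) :
    ∃ (U : X.Opens) (ψ : RealRat X), x ∈ U ∧ IsLocalEquation D U ψ := by
  induction D using TensorProduct.induction_on with
  | zero => exact ⟨⊤, 0, trivial, fun _ _ => by simp⟩
  | tmul a E =>
    obtain ⟨U, hx, φ, hφ⟩ := E.2 x
    exact ⟨U, a ⊗ₜ φ, hx, fun y hy => by simp [realGerm, hφ y hy]⟩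
  | add D E hD hE =>
    obtain ⟨U, φ, hU, hφ⟩ := hD
    obtain ⟨V, ψ, hV, hψ⟩ := hE
    exact ⟨U ⊓ V, φ + ψ, ⟨hU, hV⟩, fun y hy => by simp [hφ y hy.1, hψ y hy.2]⟩

/-- Near each point of `X` the defect is the restriction of a continuous function, by the definition
of a Green function. It is therefore bounded on each compact branch, and uniformly bounded on all
but finitely many branches by continuity at the trivial absolute value. -/
lemma exists_bound_eval_add_divLog (hX : IsRegularProjectiveCurve p) {D : RealDivisor X}
    {g : GenericFunction p} (hg : IsGreenFunction D g) :
    ∃ C : ℝ, ∀ (v : GenericAbs p) (x : X) (h : v.IsCenter x),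
      |v.eval g + v.divLog x h D| ≤ C := by
  have hloc (x : X) : ∃ (U : X.Opens) (k : BerkovichSpace p → ℝ), x ∈ U ∧
      ContinuousOn k (zariskiOpen p U) ∧ ∀ (v : GenericAbs p), ∀ y ∈ U, ∀ h : v.IsCenter y,
        v.eval g + v.divLog y h D = k v.toBerkovich := by
    obtain ⟨U, ψ, hx, hψ⟩ := exists_isLocalEquation D x
    obtain ⟨k, hk, e⟩ := hg U ψ ⟨x, hx⟩ hψ
    refine ⟨U, k, hx, hk, fun v y hy h => ?_⟩
    rw [← v.eval_eq e, map_add, v.divLog_eq_log y h (hψ y hy), v.eval_logAbs]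
  have hpt (x : X) : ∃ C : ℝ, x ≠ genericPoint X → ∀ (v : GenericAbs p) (h : v.IsCenter x),
      |v.eval g + v.divLog x h D| ≤ C := by
    by_cases hx : x = genericPoint X
    · exact ⟨0, fun h => absurd hx h⟩
    obtain ⟨U, k, hxU, hk, e⟩ := hloc x
    have hc : Continuous (k ∘ branch hX hx) :=
      hk.comp_continuous (continuous_branch hX hx) (branch_mem_zariskiOpen hX hx hxU)
    obtain ⟨C, hC⟩ := (isCompact_Icc (a := (0 : ℝ)) (b := 1)).exists_bound_of_continuousOn
      hc.continuousOn
    refine ⟨C, fun _ v h => ?_⟩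
    obtain ⟨r, hr, e'⟩ := h.exists_eq_branch hX hx
    rw [e v x hxU h, e']
    exact hC r hr
  choose C hC using hpt
  obtain ⟨U, k, hU, hk, e⟩ := hloc (genericPoint X)
  have hk0 : ContinuousAt k (GenericAbs.trivialAbs p).toBerkovich :=
    hk.continuousAt ((isOpen_zariskiOpen p U).mem_nhds hU)
  -- The exceptional centers are the finite set `B` and the finitely many points outside `U`, where
  -- `k` no longer computes the defect.
  obtain ⟨B, hB, hB'⟩ := GenericAbs.exists_finite_notMem hX (hk0.abs.eventually_lt_const
    (lt_add_one |k (GenericAbs.trivialAbs p).toBerkovich|))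
  obtain ⟨M, hM⟩ := ((hB.union (finite_compl_of_nonempty hX ⟨_, hU⟩)).image C).bddAbove
  refine ⟨max M (|k (GenericAbs.trivialAbs p).toBerkovich| + 1), fun v x h => ?_⟩
  by_cases hx : x = genericPoint X
  · subst hx
    rw [e v _ hU h, GenericAbs.eq_trivialAbs h]
    exact (le_add_of_nonneg_right zero_le_one).trans (le_max_right _ _)
  by_cases hxB : x ∈ B ∪ (U : Set X)ᶜ
  · exact (hC x hx v h).trans ((hM ⟨x, hxB, rfl⟩).trans (le_max_left _ _))
  · have hxU : x ∈ U := by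
      by_contra h'
      exact hxB (Or.inr h')
    rw [e v x hxU h]
    exact (hB' v x h fun h' => hxB (Or.inl h')).le.trans (le_max_right _ _)

end Rays
end
end TrivialArakelov

namespace TrivialArakelov

noncomputable section

open BerkovichSpace

/-! ## Existence of centers -/

section Center

variable {K : Type u} [Field K] {X : Scheme.{u}} [IsIntegral X]
  {p : X ⟶ Spec (.of K)}

namespace GenericAbs

/-- Integers come from `K`, so they have absolute value at most one, and this makes an absolute
value ultrametric. -/
lemma abv_add_le_max (v : GenericAbs p) (a b : X.functionField) :
    v.abv (a + b) ≤ max (v.abv a) (v.abv b) := by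
  let := v.abv.toNormedField
  have : IsUltrametricDist X.functionField := by
    refine IsUltrametricDist.isUltrametricDist_of_forall_norm_natCast_le_one fun n => ?_
    change v.abv (n : X.functionField) ≤ 1
    have e : (n : X.functionField) = stalkScalar p (genericPoint X) (n : K) :=
      (map_natCast (stalkScalar p (genericPoint X)) n).symm
    rw [e]
    by_cases hn : (n : K) = 0
    · rw [hn, map_zero, map_zero]
      exact zero_le_one
    · exact (v.abv_scalar _ hn).le
  exact IsUltrametricDist.norm_add_le_max a b

/-- The valuation ring of an absolute value which is trivial on `K`. -/
def valuationSubring (v : GenericAbs p) : ValuationSubring X.functionField where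
  carrier := {a | v.abv a ≤ 1}
  mul_mem' {a b} ha hb := by
    change v.abv (a * b) ≤ 1
    rw [map_mul]
    exact mul_le_one₀ ha (v.abv.nonneg b) hb
  one_mem' := (map_one v.abv).le
  add_mem' {a b} ha hb := (v.abv_add_le_max a b).trans (max_le ha hb)
  zero_mem' := (map_zero v.abv).le.trans zero_le_one
  neg_mem' {a} ha := by
    change v.abv (-a) ≤ 1
    rwa [AbsoluteValue.map_neg]
  mem_or_inv_mem' a := by
    change v.abv a ≤ 1 ∨ v.abv a⁻¹ ≤ 1
    rw [map_inv₀]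
    rcases le_total (v.abv a) 1 with h | h
    · exact Or.inl h
    · exact Or.inr (inv_le_one_of_one_le₀ h)

/-- By the valuative criterion for the proper morphism `p`, the generic point extends to a morphism
from the spectrum of the valuation ring of `v`. The image of the closed point is a center, since its
local ring maps into the valuation ring compatibly with the inclusions into `Rat(X)`. -/
lemma exists_isCenter (hX : IsRegularProjectiveCurve p) (v : GenericAbs p) :
    ∃ x, v.IsCenter x := by
  have := hX.projective.isProper
  let A := v.valuationSubring
  let i : K →+* A := (stalkScalar p (genericPoint X)).codRestrict A fun c => by
    by_cases hc : c = 0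
    · rw [hc, map_zero]; exact zero_mem A
    · exact (v.abv_scalar c hc).le
  let S : ValuativeCommSq p :=
    { R := A
      K := X.functionField
      i₁ := X.fromSpecStalk (genericPoint X)
      i₂ := Spec.map (CommRingCat.ofHom i)
      commSq := ⟨by
        refine (fromSpecStalk_comp p (genericPoint X)).trans ?_
        rw [← Spec.map_comp]
        rfl⟩ }
  have hS : S.commSq.HasLift := by
    have : UniversallyClosed p := inferInstance
    rw [UniversallyClosed.eq_valuativeCriterion] at this
    exact this.1 S
  obtain ⟨⟨l, hl, -⟩⟩ := hS.exists_lift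
  refine ⟨l (IsLocalRing.closedPoint A), ?_⟩
  have e : Scheme.stalkClosedPointTo l ≫ CommRingCat.ofHom (algebraMap A X.functionField) =
      X.presheaf.stalkSpecializes ((genericPoint_spec X).specializes trivial) := by
    rw [← Spec.map_inj, ← cancel_mono (X.fromSpecStalk (l (IsLocalRing.closedPoint A)))]
    rw [Spec.map_comp, Category.assoc, Scheme.Spec_stalkClosedPointTo_fromSpecStalk]
    refine Eq.trans hl ?_
    exact (Scheme.SpecMap_stalkSpecializes_fromSpecStalk _).symm
  rintro _ ⟨a, rfl⟩
  have ha : algebraMap A X.functionField (Scheme.stalkClosedPointTo l a) =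
      algebraMap (X.presheaf.stalk _) X.functionField a :=
    DFunLike.congr_fun (CommRingCat.hom_ext_iff.mp e) a
  rw [← ha]
  exact (Scheme.stalkClosedPointTo l a : A).2

end GenericAbs
end Center
end
end TrivialArakelov

namespace TrivialArakelov

noncomputable section

open BerkovichSpace

/-! ## Divisors on regular curves -/

section Divisors

variable {K : Type u} [Field K] {X : Scheme.{u}} [IsIntegral X]
  {p : X ⟶ Spec (.of K)}

/-- A rational function which is regular at every point is a global section. -/
lemma exists_section_of_forall_mem (a : X.functionField) (ha : ∀ x : X, a ∈ localRing x) :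
    ∃ s : Γ(X, ⊤), X.presheaf.germ ⊤ (genericPoint X) trivial s = a := by
  have hloc (x : X) : ∃ (U : X.Opens) (hx : x ∈ U) (s : Γ(X, U)),
      X.presheaf.germ U (genericPoint X) (mem_genericPoint ⟨x, hx⟩) s = a := by
    obtain ⟨b, hb⟩ := ha x
    obtain ⟨U, hU, s, rfl⟩ := X.presheaf.exists_germ_eq b
    exact ⟨U, hU, s, (algebraMap_stalk_eq x U hU _ s).symm.trans hb⟩
  choose U hU s hs using hloc
  have hc : TopCat.Presheaf.IsCompatible X.presheaf U s := by
    intro x y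
    have hη : genericPoint X ∈ U x ⊓ U y :=
      ⟨mem_genericPoint ⟨x, hU x⟩, mem_genericPoint ⟨y, hU y⟩⟩
    refine germ_injective_of_isIntegral X _ hη ?_
    rw [TopCat.Presheaf.germ_res_apply, TopCat.Presheaf.germ_res_apply, hs, hs]
  have htop : (⊤ : X.Opens) ≤ iSup U := fun x _ => Opens.mem_iSup.mpr ⟨x, hU x⟩
  obtain ⟨t, ht, -⟩ := X.sheaf.existsUnique_gluing' U ⊤ (fun x => homOfLE le_top) htop s hc
  refine ⟨t, ?_⟩
  rw [← hs (genericPoint X), ← ht (genericPoint X)]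
  exact (TopCat.Presheaf.germ_res_apply X.presheaf _ _ _ _).symm

lemma exists_ne_genericPoint (hX : IsRegularProjectiveCurve p) : ∃ x : X, x ≠ genericPoint X := by
  by_contra! h
  have hs : Subsingleton X := ⟨fun a b => (h a).trans (h b).symm⟩
  have hdim : Order.krullDim X = 1 := by
    rw [← hX.dim_eq_one, topologicalKrullDim]
    exact (Order.krullDim_eq_of_orderIso (irreducibleSetEquivPoints (α := X))).symm
  have := Order.krullDim_nonpos_of_subsingleton (α := X)
  rw [hdim] at this
  norm_num at this

variable [IsLocallyNoetherian X]

/-- A rational function without poles has no zeros. -/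
lemma ord_eq_zero_of_forall_nonneg (hX : IsRegularProjectiveCurve p) (φ : RatUnits X)
    (h : ∀ x ≠ genericPoint X, 0 ≤ Scheme.ord φ.val x) (x : X) : Scheme.ord φ.val x = 0 := by
  have := hX.projective.isProper
  obtain ⟨s, hs⟩ := exists_section_of_forall_mem φ.val fun x => by
    by_cases hx : x = genericPoint X
    · subst hx
      exact ⟨φ.val, algebraMap_genericPoint φ.val⟩
    · exact (mem_localRing_iff hX hx).mpr (h x hx)
  have hs0 : s ≠ 0 := by
    rintro rfl
    exact φ.val_ne_zero (hs.symm.trans (map_zero _))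
  -- The global functions on an integral proper scheme over a field form a field, so a non-zero one
  -- is a unit at every point.
  obtain ⟨t, ht⟩ := (isField_of_universallyClosed K p).mul_inv_cancel hs0
  have hu : IsUnit (X.presheaf.germ ⊤ x trivial s) :=
    (IsUnit.of_mul_eq_one t ht).map (X.presheaf.germ ⊤ x trivial).hom
  rw [← hs]
  exact (congrArg (Scheme.ord · x) (algebraMap_stalk_eq x ⊤ trivial trivial s)).symm.trans
    (ord_of_isUnit hu)

/-- The order of a Cartier divisor at a point. -/
def ordCartier (x : X) : CartierDivisor X →+ ℤ :=
  ((ordGerm x).comp (Pi.evalAddMonoidHom (fun x : X => DivisorGerm X x) x)).comp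
    (CartierDivisor X).subtype

lemma ordGerm_toGerm (x : X) (φ : RatUnits X) :
    ordGerm x (toGerm X x (Additive.ofMul φ)) = Scheme.ord φ.val x := rfl

lemma ordCartier_of_eq {x : X} {E : CartierDivisor X} {φ : RatUnits X}
    (h : E.1 x = toGerm X x (Additive.ofMul φ)) : ordCartier x E = Scheme.ord φ.val x :=
  (congrArg (ordGerm x) h).trans (ordGerm_toGerm x φ)

lemma ordCartier_principalInt (x : X) (φ : RatUnits X) :
    ordCartier x (principalInt X (Additive.ofMul φ)) = Scheme.ord φ.val x := rfl

lemma ordCartier_genericPoint (E : CartierDivisor X) : ordCartier (genericPoint X) E = 0 := by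
  obtain ⟨U, hU, φ, hφ⟩ := E.2 (genericPoint X)
  rw [ordCartier_of_eq (φ := φ.toMul) (hφ _ hU)]
  exact ord_eq_zero_of_mem_localUnits (mem_localUnits_genericPoint _)

omit [IsLocallyNoetherian X] in
lemma toGerm_eq_zero {x : X} {φ : RatUnits X} (h : φ ∈ localUnits X x) :
    toGerm X x (Additive.ofMul φ) = 0 :=
  (QuotientGroup.eq_one_iff (N := localUnits X x) φ).mpr h

lemma germ_eq_zero_of_ord (hX : IsRegularProjectiveCurve p) (x : X) (γ : DivisorGerm X x)
    (h : ordGerm x γ = 0) : γ = 0 := by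
  obtain ⟨φ, rfl⟩ : ∃ φ, toGerm X x φ = γ := QuotientGroup.mk'_surjective _ γ
  refine toGerm_eq_zero (φ := φ.toMul) ?_
  by_cases hx : x = genericPoint X
  · subst hx
    exact mem_localUnits_genericPoint _
  · exact (mem_localUnits_iff hX hx).mpr h

lemma cartierDivisor_ext (hX : IsRegularProjectiveCurve p) {D E : CartierDivisor X}
    (h : ∀ x, ordCartier x D = ordCartier x E) : D = E := by
  rw [← sub_eq_zero]
  refine Subtype.ext (funext fun x => germ_eq_zero_of_ord hX x _ ?_)
  change ordCartier x (D - E) = 0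
  rw [map_sub, h, sub_self]

lemma finite_ordCartier_ne_zero (hX : IsRegularProjectiveCurve p) (E : CartierDivisor X) :
    {x | ordCartier x E ≠ 0}.Finite := by
  obtain ⟨U, hU, φ, hφ⟩ := E.2 (genericPoint X)
  refine ((finite_compl_of_nonempty hX ⟨_, hU⟩).union (finite_ord_ne_zero hX φ.toMul)).subset ?_
  intro x hx
  by_contra h
  simp only [Set.mem_union, not_or, Set.mem_compl_iff, not_not, Set.mem_ofPred_eq] at h
  exact hx ((ordCartier_of_eq (φ := φ.toMul) (hφ x h.1)).trans h.2)

/-- The complement of a finite set of closed points. -/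
def finiteCompl (hX : IsRegularProjectiveCurve p) (B : Set X) (hB : B.Finite)
    (h : genericPoint X ∉ B) : X.Opens where
  carrier := Bᶜ
  is_open' := by
    rw [isOpen_compl_iff, ← Set.biUnion_of_singleton B]
    refine hB.isClosed_biUnion fun x hx => isClosed_singleton hX ?_
    rintro rfl
    exact h hx

-- The local equation is a uniformizer `ϖ` at `x` and `1` elsewhere. The two descriptions are
-- compatible near `x`, once the finitely many other points where `ϖ` is not a unit are removed.
open Classical in
lemma exists_pointDivisor (hX : IsRegularProjectiveCurve p) {x : X} (hx : x ≠ genericPoint X) :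
    ∃ E : CartierDivisor X, EffectiveInt E ∧ ∀ y, ordCartier y E = if y = x then 1 else 0 := by
  obtain ⟨ϖ, hϖ⟩ := exists_ord_eq_one hX hx
  let φ : X → RatUnits X := fun y => if y = x then ϖ else 1
  let E : CartierDivisor X := ⟨fun y => toGerm X y (Additive.ofMul (φ y)), fun y => by
    by_cases hy : y = x
    · subst hy
      refine ⟨finiteCompl hX {z | ϖ ∉ localUnits X z ∧ z ≠ y}
        ((finite_not_mem_localUnits hX ϖ).subset fun z hz => hz.1)
        (fun h => h.1 (mem_localUnits_genericPoint _)), fun h => h.2 rfl, Additive.ofMul ϖ, ?_⟩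
      intro z hz
      by_cases hzy : z = y
      · simp only [φ, if_pos hzy]
      · simp only [φ, if_neg hzy]
        rw [toGerm_eq_zero (φ := ϖ), ofMul_one, map_zero]
        by_contra h
        exact hz ⟨h, hzy⟩
    · refine ⟨finiteCompl hX {x} (Set.finite_singleton x) (fun h => hx h.symm), hy, 0, ?_⟩
      intro z hz
      have hz' : z ≠ x := hz
      simp only [φ, if_neg hz', ofMul_one]⟩
  have hord (y : X) : Scheme.ord (φ y).val y = if y = x then 1 else 0 := by
    by_cases hy : y = x
    · subst hy
      simp only [φ, if_true, hϖ]
    · simp only [φ, if_neg hy, map_one, ord_one]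
  refine ⟨E, fun y => ?_, fun y => (ordCartier_of_eq rfl).trans (hord y)⟩
  have hm : (φ y).val ∈ localRing y := by
    by_cases hy : y = genericPoint X
    · subst hy
      exact ⟨(φ (genericPoint X)).val, algebraMap_genericPoint _⟩
    · rw [mem_localRing_iff hX hy, hord]
      split_ifs <;> norm_num
  obtain ⟨a, ha⟩ := hm
  exact ⟨a, φ y, ha, rfl⟩

open Classical in
/-- The effective Cartier divisor of a closed point. -/
def pointDivisor (hX : IsRegularProjectiveCurve p) {x : X} (hx : x ≠ genericPoint X) :
    CartierDivisor X := (exists_pointDivisor hX hx).choose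

lemma effectiveInt_pointDivisor (hX : IsRegularProjectiveCurve p) {x : X}
    (hx : x ≠ genericPoint X) : EffectiveInt (pointDivisor hX hx) :=
  (exists_pointDivisor hX hx).choose_spec.1

open Classical in
lemma ordCartier_pointDivisor (hX : IsRegularProjectiveCurve p) {x : X}
    (hx : x ≠ genericPoint X) (y : X) :
    ordCartier y (pointDivisor hX hx) = if y = x then 1 else 0 :=
  (exists_pointDivisor hX hx).choose_spec.2 y

/-- Every Cartier divisor is a combination of closed points. -/
lemma cartierDivisor_mem_closure (hX : IsRegularProjectiveCurve p) (E : CartierDivisor X) :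
    E ∈ AddSubgroup.closure {D | ∃ (x : X) (hx : x ≠ genericPoint X), D = pointDivisor hX hx} := by
  classical
  have hfin := finite_ordCartier_ne_zero hX E
  -- The value at the generic point is immaterial, since Cartier divisors have order zero there.
  let P : X → CartierDivisor X := fun x =>
    if hx : x = genericPoint X then 0 else pointDivisor hX hx
  have e : E = ∑ x ∈ hfin.toFinset, ordCartier x E • P x := by
    refine cartierDivisor_ext hX fun y => ?_
    rw [map_sum]
    have hP (x : X) : ordCartier y (ordCartier x E • P x) =
        if y = x then ordCartier y E else 0 := by
      rw [map_zsmul]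
      by_cases hx : x = genericPoint X
      · simp only [P, dif_pos hx, map_zero, smul_zero]
        split_ifs with hy
        · rw [hy, hx, ordCartier_genericPoint]
        · rfl
      · simp only [P, dif_neg hx, ordCartier_pointDivisor]
        split_ifs with hy
        · rw [hy]; simp
        · simp
    simp only [hP, Finset.sum_ite_eq, Set.Finite.mem_toFinset, Set.mem_ofPred_eq]
    split_ifs with h
    · rfl
    · exact not_not.mp h
  rw [e]
  refine sum_mem fun x _ => zsmul_mem ?_ _
  by_cases hx : x = genericPoint X
  · simp only [P, dif_pos hx]
    exact zero_mem _
  · simp only [P, dif_neg hx]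
    exact AddSubgroup.subset_closure ⟨x, hx, rfl⟩

/-! ### Picard groups of rank one -/

/-- Tensoring with `ℚ` is localization at the non-zero integers, so its kernel is the torsion. -/
lemma exists_zsmul_eq_zero {M : Type*} [AddCommGroup M] {m : M}
    (h : (1 : ℚ) ⊗ₜ[ℤ] m = 0) : ∃ n : ℤ, n ≠ 0 ∧ n • m = 0 := by
  have : IsLocalizedModule (nonZeroDivisors ℤ) (TensorProduct.mk ℤ ℚ M 1) :=
    (isLocalizedModule_iff_isBaseChange (nonZeroDivisors ℤ) ℚ _).mpr
      (TensorProduct.isBaseChange ℤ M ℚ)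
  obtain ⟨c, hc⟩ := (IsLocalizedModule.eq_zero_iff (nonZeroDivisors ℤ)
    (TensorProduct.mk ℤ ℚ M 1)).mp h
  exact ⟨c, nonZeroDivisors.ne_zero c.2, hc⟩

lemma exists_ord_eq_of_zsmul_eq_zero {E : CartierDivisor X}
    {n : ℤ} (h : n • (QuotientAddGroup.mk E : PicGroup X) = 0) :
    ∃ φ : RatUnits X, ∀ z, Scheme.ord φ.val z = n * ordCartier z E := by
  obtain ⟨φ, hφ⟩ := (QuotientAddGroup.eq_zero_iff (n • E)).mp h
  refine ⟨φ.toMul, fun z => ?_⟩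
  rw [← ordCartier_principalInt, ← smul_eq_mul, ← map_zsmul, ← hφ]
  rfl

/-- On a curve whose Picard group has rank one, any two closed points are the zero and the pole of
a rational function. -/
lemma exists_ord_of_picRankOne (hX : IsRegularProjectiveCurve p) (hPic : PicRankOne X) {x y : X}
    (hx : x ≠ genericPoint X) (hy : y ≠ genericPoint X) (hxy : x ≠ y) :
    ∃ (φ : RatUnits X) (a b : ℤ), 0 < a ∧ 0 < b ∧ Scheme.ord φ.val x = a ∧
      Scheme.ord φ.val y = -b ∧ ∀ z, z ≠ x → z ≠ y → Scheme.ord φ.val z = 0 := by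
  let P : CartierDivisor X := pointDivisor hX hx
  let Q : CartierDivisor X := pointDivisor hX hy
  -- The class of a point is not torsion: otherwise a positive multiple of the point would be the
  -- divisor of a function with a zero and no pole.
  have hQ : (1 : ℚ) ⊗ₜ[ℤ] (QuotientAddGroup.mk Q : PicGroup X) ≠ 0 := by
    intro h
    obtain ⟨n, hn, h⟩ := exists_zsmul_eq_zero h
    wlog hn0 : 0 < n generalizing n
    · exact this (-n) (neg_ne_zero.mpr hn) (by rw [neg_smul, h, neg_zero]) (by omega)
    obtain ⟨φ, hφ⟩ := exists_ord_eq_of_zsmul_eq_zero h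
    have h1 := ord_eq_zero_of_forall_nonneg hX φ (fun z _ => by
      rw [hφ, ordCartier_pointDivisor]; split_ifs <;> simp [hn0.le]) y
    rw [hφ, ordCartier_pointDivisor, if_pos rfl] at h1
    omega
  have hr : Module.finrank ℚ (ℚ ⊗[ℤ] PicGroup X) = 1 := Module.finrank_eq_of_rank_eq hPic
  obtain ⟨c, hc⟩ := (finrank_eq_one_iff_of_nonzero' _ hQ).mp hr
    ((1 : ℚ) ⊗ₜ[ℤ] (QuotientAddGroup.mk P : PicGroup X))
  -- In rank one `[P] = c [Q]` rationally. Clearing the denominator of `c`, and then the torsion,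
  -- yields a principal divisor supported on `x` and `y`.
  have h0 : (1 : ℚ) ⊗ₜ[ℤ] (QuotientAddGroup.mk ((c.den : ℤ) • P - c.num • Q) : PicGroup X) = 0 := by
    have e : (QuotientAddGroup.mk ((c.den : ℤ) • P - c.num • Q) : PicGroup X) =
      (c.den : ℤ) • QuotientAddGroup.mk P - c.num • QuotientAddGroup.mk Q := rfl
    rw [e, TensorProduct.tmul_sub, TensorProduct.tmul_smul, TensorProduct.tmul_smul, ← hc,
      ← Int.cast_smul_eq_zsmul ℚ, ← Int.cast_smul_eq_zsmul ℚ, smul_smul, ← sub_smul]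
    have : ((c.den : ℤ) : ℚ) * c - (c.num : ℚ) = 0 := by
      rw [Int.cast_natCast, Rat.den_mul_eq_num, sub_self]
    rw [this, zero_smul]
  obtain ⟨n, hn, h⟩ := exists_zsmul_eq_zero h0
  wlog hn0 : 0 < n generalizing n
  · exact this (-n) (neg_ne_zero.mpr hn) (by rw [neg_smul, h, neg_zero]) (by omega)
  obtain ⟨φ, hφ⟩ := exists_ord_eq_of_zsmul_eq_zero h
  classical
  simp only [map_sub, map_zsmul, P, Q, ordCartier_pointDivisor] at hφ
  have ha : 0 < n * (c.den : ℤ) := mul_pos hn0 (by exact_mod_cast c.den_pos)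
  have hx' : Scheme.ord φ.val x = n * c.den := by rw [hφ]; simp [hxy]
  have hy' : Scheme.ord φ.val y = -(n * c.num) := by rw [hφ]; simp [hxy.symm]
  have hz' (z : X) (h1 : z ≠ x) (h2 : z ≠ y) : Scheme.ord φ.val z = 0 := by
    rw [hφ]; simp [h1, h2]
  refine ⟨φ, _, _, ha, ?_, hx', hy', hz'⟩
  -- If `c` were not positive, `φ` would have a zero at `x` and no pole.
  by_contra! hb
  have := ord_eq_zero_of_forall_nonneg hX φ (fun z _ => by
    by_cases h1 : z = x
    · rw [h1, hx']; exact ha.le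
    by_cases h2 : z = y
    · rw [h2, hy']; linarith
    · exact (hz' z h1 h2).ge) x
  omega

end Divisors
end
end TrivialArakelov

namespace TrivialArakelov

noncomputable section

open BerkovichSpace

/-! ## Filtered vector spaces -/

section Filtered

variable {K F κ : Type*} [Field K] [AddCommGroup F] [Module K F] [AddCommGroup κ] [Module K κ]

lemma finrank_sup_of_disjoint {V W : Submodule K F} [Module.Finite K V] [Module.Finite K W]
    (h : V ⊓ W = ⊥) :
    Module.finrank K (V ⊔ W : Submodule K F) = Module.finrank K V + Module.finrank K W := by
  rw [← Submodule.finrank_sup_add_finrank_inf_eq, h, finrank_bot, add_zero]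

variable {L : ℤ → Submodule K F} (hL : Antitone L)
  (hρ : ∀ n, ∃ ρ : L n →ₗ[K] κ, Function.Surjective ρ ∧ ∀ a, ρ a = 0 ↔ (a : F) ∈ L (n + 1))

include hρ in
-- Each of the `k` steps of the filtration from `L n` to `L (n + k)` contributes at most one copy of
-- `κ`, as its graded piece is `κ`.
lemma finrank_le_of_inf_eq_bot [Module.Finite K κ] (k : ℕ) (n : ℤ) (V : Submodule K F)
    [Module.Finite K V] (hV : V ≤ L n) (h : V ⊓ L (n + k) = ⊥) :
    Module.finrank K V ≤ k * Module.finrank K κ := by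
  induction k generalizing n V with
  | zero =>
    rw [Nat.cast_zero, add_zero, inf_eq_left.mpr hV] at h
    rw [h]; simp
  | succ k ih =>
    obtain ⟨ρ, -, hk⟩ := hρ n
    let f : V →ₗ[K] κ := ρ ∘ₗ Submodule.inclusion hV
    have hker : f.ker = (L (n + 1)).comap V.subtype := by
      ext a
      exact hk _
    have h1 := f.finrank_range_add_finrank_ker
    have h2 : Module.finrank K f.range ≤ Module.finrank K κ := Submodule.finrank_le _
    have h3 : Module.finrank K f.ker = Module.finrank K (V ⊓ L (n + 1) : Submodule K F) := by
      rw [hker, ← Submodule.map_comap_subtype, Submodule.finrank_map_subtype_eq]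
    have : Module.Finite K (V ⊓ L (n + 1) : Submodule K F) :=
      Submodule.finiteDimensional_inf_left _ _
    have h4 := ih (n + 1) (V ⊓ L (n + 1)) inf_le_right (by
      rw [eq_bot_iff, ← h]
      refine inf_le_inf inf_le_left (le_of_eq ?_)
      congr 1
      push_cast; ring)
    rw [add_mul, one_mul]
    omega

include hL hρ in
-- This complements the previous bound by a space attaining it: `W` is the sum of lifts of `κ` from
-- each of the `k` graded pieces.
lemma exists_finrank_eq_inf_eq_bot [Module.Finite K κ] (k : ℕ) (n : ℤ) :
    ∃ W : Submodule K F, Module.Finite K W ∧ W ≤ L n ∧ W ⊓ L (n + k) = ⊥ ∧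
      Module.finrank K W = k * Module.finrank K κ := by
  induction k generalizing n with
  | zero => exact ⟨⊥, inferInstance, bot_le, bot_inf_eq _, by simp⟩
  | succ k ih =>
    obtain ⟨W, hW, hWn, hWb, hWr⟩ := ih (n + 1)
    obtain ⟨ρ, hs, hk⟩ := hρ n
    obtain ⟨g, hg⟩ := ρ.exists_rightInverse_of_surjective (LinearMap.range_eq_top.mpr hs)
    have hgi (b : κ) : ρ (g b) = b := LinearMap.congr_fun hg b
    have hinj : Function.Injective ((L n).subtype ∘ₗ g) :=
      Subtype.val_injective.comp (Function.LeftInverse.injective hgi)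
    let S := ((L n).subtype ∘ₗ g).range
    have hSn : S ≤ L n := by
      rintro _ ⟨b, rfl⟩
      exact (g b).2
    have hSb {s : F} (h1 : s ∈ S) (h2 : s ∈ L (n + 1)) : s = 0 := by
      obtain ⟨b, rfl⟩ := h1
      have := (hk (g b)).mpr h2
      rw [hgi] at this
      rw [this, map_zero]
    have e : n + 1 + (k : ℤ) = n + (k + 1 : ℕ) := by push_cast; ring
    rw [e] at hWb
    have hSW : S ⊓ W = ⊥ := by
      rw [eq_bot_iff]
      rintro s ⟨h1, h2⟩
      exact hSb h1 (hWn h2)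
    refine ⟨S ⊔ W, inferInstance, sup_le hSn (hWn.trans (hL (by omega))), ?_, ?_⟩
    · rw [eq_bot_iff]
      rintro _ ⟨h1, h2⟩
      obtain ⟨s, hs, w, hw, rfl⟩ := Submodule.mem_sup.mp h1
      have hs0 : s = 0 := by
        refine hSb hs ?_
        have h3 : s + w ∈ L (n + 1) := hL (by omega) h2
        simpa using sub_mem h3 (hWn hw)
      subst hs0
      rw [zero_add] at h2 ⊢
      have : w ∈ W ⊓ L (n + (k + 1 : ℕ)) := ⟨hw, h2⟩
      rwa [hWb] at this
    · rw [finrank_sup_of_disjoint hSW, LinearMap.finrank_range_of_inj hinj, hWr]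
      ring

/-- The space is `W ⊕ μ W ⊕ … ⊕ μ ^ m W`. The sum is direct because everything after the first
summand lies in `B`, which meets `W` trivially. -/
lemma exists_finrank_eq_of_map_le {W A B : Submodule K F} [Module.Finite K W] {μ : F →ₗ[K] F}
    (hμ : Function.Injective μ) {N : ℕ → Submodule K F} (hN : Monotone N)
    (hWN : W ≤ N 0) (hμN : ∀ j, (N j).map μ ≤ N (j + 1)) (hWA : W ≤ A) (hBA : B ≤ A)
    (hμA : A.map μ ≤ B) (hWB : W ⊓ B = ⊥) (m : ℕ) :
    ∃ V : Submodule K F, Module.Finite K V ∧ V ≤ N m ⊓ A ∧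
      Module.finrank K V = (m + 1) * Module.finrank K W := by
  induction m with
  | zero => exact ⟨W, inferInstance, le_inf hWN hWA, by simp⟩
  | succ m ih =>
    obtain ⟨V, hV, hVN, hVr⟩ := ih
    have hVB : V.map μ ≤ B := (Submodule.map_mono (hVN.trans inf_le_right)).trans hμA
    refine ⟨W ⊔ V.map μ, inferInstance, sup_le (le_inf (hWN.trans (hN (Nat.zero_le _))) hWA)
      (le_inf ?_ (hVB.trans hBA)), ?_⟩
    · exact (Submodule.map_mono (hVN.trans inf_le_left)).trans (hμN m)
    · rw [finrank_sup_of_disjoint (eq_bot_iff.mpr ((inf_le_inf_left _ hVB).trans hWB.le)),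
        ← (Submodule.equivMapOfInjective μ hμ V).finrank_eq, hVr]
      ring

end Filtered

/-! ## Degrees of zeros and poles -/

section Degree

variable {K : Type u} [Field K] {X : Scheme.{u}} [IsIntegral X]

/-- The function field of `X`, as an extension of `K`. -/
def RatField (_p : X ⟶ Spec (.of K)) : Type u := X.functionField

instance (p : X ⟶ Spec (.of K)) : Field (RatField p) := inferInstanceAs (Field X.functionField)

instance (p : X ⟶ Spec (.of K)) : Algebra K (RatField p) :=
  (stalkScalar p (genericPoint X) : K →+* X.functionField).toAlgebra

/-- The residue field at `x`, as an extension of `K`. -/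
def ResField (_p : X ⟶ Spec (.of K)) (x : X) : Type u := X.residueField x

instance (p : X ⟶ Spec (.of K)) (x : X) : Field (ResField p x) :=
  inferInstanceAs (Field (X.residueField x))

instance (p : X ⟶ Spec (.of K)) (x : X) : Algebra K (ResField p x) := (scalarMap p x).toAlgebra

variable {p : X ⟶ Spec (.of K)}

lemma finite_resField (hX : IsRegularProjectiveCurve p) {x : X} (hx : x ≠ genericPoint X) :
    Module.Finite K (ResField p x) := finite_residueField hX hx

omit [IsIntegral X] in
lemma residueDegree_eq (x : X) : residueDegree p x = Module.finrank K (ResField p x) := rfl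

lemma residueDegree_pos (hX : IsRegularProjectiveCurve p) {x : X} (hx : x ≠ genericPoint X) :
    0 < residueDegree p x := by
  have := finite_resField hX hx
  rw [residueDegree_eq]
  exact Module.finrank_pos

variable [IsLocallyNoetherian X]

/-- The order at `x` of an element of the function field. -/
def ordRat (x : X) (a : RatField p) : ℤ := Scheme.ord (X := X) a x

lemma ordRat_mul {x : X} {a b : RatField p} (ha : a ≠ 0) (hb : b ≠ 0) :
    ordRat x (a * b) = ordRat x a + ordRat x b := Scheme.ord_mul (X := X) ha hb

/-- The rational functions of order at least `n` at `x`. -/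
def ordGE (hX : IsRegularProjectiveCurve p) {x : X} (hx : x ≠ genericPoint X) (n : ℤ) :
    Submodule K (RatField p) where
  -- The order of the zero function is by convention zero, so that function has to be admitted
  -- separately.
  carrier := {a | a = 0 ∨ n ≤ ordRat x a}
  zero_mem' := Or.inl rfl
  add_mem' := by
    intro a b ha hb
    by_cases h0 : a = 0
    · rwa [h0, zero_add]
    by_cases h1 : b = 0
    · rwa [h1, add_zero]
    refine or_iff_not_imp_left.mpr fun h2 => ?_
    exact (le_min (ha.resolve_left h0) (hb.resolve_left h1)).trans (ord_add_le hX hx h2)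
  smul_mem' := by
    intro c a ha
    by_cases h0 : c • a = 0
    · exact Or.inl h0
    have hc : c ≠ 0 := fun h => h0 (by rw [h, zero_smul])
    have ha0 : a ≠ 0 := fun h => h0 (by rw [h, smul_zero])
    right
    have hc' : algebraMap K (RatField p) c ≠ 0 := (map_ne_zero _).mpr hc
    have hu : IsUnit (stalkScalar p x c) := (IsUnit.mk0 c hc).map _
    have h1 : ordRat x (algebraMap K (RatField p) c) = 0 :=
      (congrArg (Scheme.ord (X := X) · x) (algebraMap_stalkScalar x c)).symm.trans (ord_of_isUnit hu)
    rw [Algebra.smul_def, ordRat_mul hc' ha0, h1, zero_add]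
    exact ha.resolve_left ha0

lemma mem_ordGE (hX : IsRegularProjectiveCurve p) {x : X} (hx : x ≠ genericPoint X) {n : ℤ}
    {a : RatField p} : a ∈ ordGE hX hx n ↔ a = 0 ∨ n ≤ ordRat x a := Iff.rfl

lemma antitone_ordGE (hX : IsRegularProjectiveCurve p) {x : X} (hx : x ≠ genericPoint X) :
    Antitone (ordGE hX hx) := fun _ _ h _ ha => ha.imp_right h.trans

lemma mul_mem_ordGE (hX : IsRegularProjectiveCurve p) {x : X} (hx : x ≠ genericPoint X) {n : ℤ}
    {θ a : RatField p} (hθ : θ ≠ 0) : θ * a ∈ ordGE hX hx (n + ordRat x θ) ↔ a ∈ ordGE hX hx n := by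
  by_cases ha : a = 0
  · simp [ha, zero_mem]
  rw [mem_ordGE, mem_ordGE, ordRat_mul hθ ha]
  simp only [mul_eq_zero, hθ, ha, false_or]
  omega

/-- The graded pieces of the filtration by the order at `x`. -/
lemma exists_leadingCoeff (hX : IsRegularProjectiveCurve p) {x : X} (hx : x ≠ genericPoint X)
    (n : ℤ) : ∃ ρ : ordGE hX hx n →ₗ[K] ResField p x, Function.Surjective ρ ∧
      ∀ a, ρ a = 0 ↔ (a : RatField p) ∈ ordGE hX hx (n + 1) := by
  obtain ⟨ϖ, hϖ⟩ := exists_ord_eq_one hX hx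
  let : Algebra K (X.presheaf.stalk x) := (stalkScalar p x).toAlgebra
  -- Multiplication by `ϖ ^ n` identifies the local ring with the functions of order at least `n`.
  -- The leading coefficient is the residue of the corresponding element of the local ring.
  let τ : RatField p := (ϖ.val : X.functionField) ^ n
  have hτ : τ ≠ 0 := zpow_ne_zero n ϖ.val_ne_zero
  have hτo : ordRat x τ = n := by
    have h2 := congrArg Multiplicative.toAdd (map_zpow (ordUnits x) ϖ n)
    rw [toAdd_zpow] at h2
    change Scheme.ord (ϖ ^ n).val x = n • Scheme.ord ϖ.val x at h2
    rw [hϖ, smul_eq_mul, mul_one] at h2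
    rw [← h2]
    exact congrArg (Scheme.ord (X := X) · x)
      (Units.val_zpow_eq_zpow_val (α := X.functionField) _ _).symm
  let i : X.presheaf.stalk x →+* RatField p :=
    (algebraMap (X.presheaf.stalk x) X.functionField : _ →+* X.functionField)
  have hi : Function.Injective i := algebraMap_stalk_injective x
  have hmem (a : RatField p) : a ∈ ordGE hX hx 0 ↔ ∃ b, i b = a := by
    by_cases ha : a = 0
    · exact iff_of_true (Or.inl ha) ⟨0, by rw [ha, map_zero]⟩
    · rw [mem_ordGE, or_iff_right ha]
      exact (mem_localRing_iff hX hx).symm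
  have hσm (b : X.presheaf.stalk x) : τ * i b ∈ ordGE hX hx n := by
    have := (mul_mem_ordGE hX hx (n := 0) hτ).mpr ((hmem (i b)).mpr ⟨b, rfl⟩)
    rwa [hτo, zero_add] at this
  have hic (c : K) : i (algebraMap K (X.presheaf.stalk x) c) = algebraMap K (RatField p) c :=
    algebraMap_stalkScalar x c
  let σ : X.presheaf.stalk x →ₗ[K] ordGE hX hx n :=
    { toFun := fun b => ⟨τ * i b, hσm b⟩
      map_add' := fun b c => Subtype.ext (by simp [mul_add])
      map_smul' := fun c b => Subtype.ext (by
        simp only [Algebra.smul_def, map_mul, hic, RingHom.id_apply, Submodule.coe_smul]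
        ring) }
  have hσ : Function.Bijective σ := by
    constructor
    · intro b c h
      exact hi (mul_left_cancel₀ hτ (congrArg Subtype.val h))
    · rintro ⟨a, ha⟩
      have h1 : τ⁻¹ * a ∈ ordGE hX hx 0 := by
        rw [← mul_mem_ordGE hX hx hτ, hτo, zero_add, mul_inv_cancel_left₀ hτ]
        exact ha
      obtain ⟨b, hb⟩ := (hmem _).mp h1
      refine ⟨b, Subtype.ext ?_⟩
      change τ * i b = a
      rw [hb, mul_inv_cancel_left₀ hτ]
  let r : X.presheaf.stalk x →ₗ[K] ResField p x :=
    { toFun := fun b => X.residue x b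
      map_add' := fun b c => map_add (X.residue x).hom b c
      map_smul' := fun c b => by
        simp only [Algebra.smul_def, RingHom.id_apply]
        exact map_mul (X.residue x).hom _ _ }
  let e := LinearEquiv.ofBijective σ hσ
  refine ⟨r ∘ₗ e.symm.toLinearMap, (X.residue_surjective x).comp e.symm.surjective, fun a => ?_⟩
  obtain ⟨b, rfl⟩ := e.surjective a
  have h1 : (r ∘ₗ e.symm.toLinearMap) (e b) = X.residue x b :=
    congrArg (fun c => X.residue x c) (e.symm_apply_apply b)
  rw [h1]
  have h2 : (X.residue x b : ResField p x) = 0 ↔ ¬ IsUnit b :=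
    Ideal.Quotient.eq_zero_iff_mem.trans (IsLocalRing.mem_maximalIdeal _)
  refine h2.trans ?_
  change _ ↔ τ * i b ∈ _
  by_cases hb : b = 0
  · simp [hb, zero_mem]
  have hb' : i b ≠ 0 := by rwa [ne_eq, map_eq_zero_iff i hi]
  rw [add_comm, ← hτo, mul_mem_ordGE hX hx hτ, mem_ordGE, or_iff_right hb']
  have h3 : 0 ≤ ordRat x (i b) := ((hmem _).mpr ⟨b, rfl⟩).resolve_left hb'
  have h4 : ordRat x (i b) = 0 ↔ IsUnit b := by
    refine ⟨fun h => ?_, fun h => ord_of_isUnit h⟩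
    obtain ⟨w, hw⟩ := mem_localUnits.mp
      ((mem_localUnits_iff hX hx (φ := .mk (i b) hb')).mpr h)
    exact hi hw ▸ w.isUnit
  rw [← h4]
  omega

/-! ### Counting functions whose only pole is `y` -/

/-- The rational functions which are regular away from `y`. -/
def regularAway (hX : IsRegularProjectiveCurve p) (y : X) : Submodule K (RatField p) :=
  ⨅ (z : X) (hz : z ≠ genericPoint X) (_ : z ≠ y), ordGE hX hz 0

lemma mem_regularAway (hX : IsRegularProjectiveCurve p) {y : X} {a : RatField p} :
    a ∈ regularAway hX y ↔ ∀ (z : X) (hz : z ≠ genericPoint X), z ≠ y → a ∈ ordGE hX hz 0 := by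
  simp [regularAway, Submodule.mem_iInf]

/-- A non-zero function in this intersection would have a zero at `y` and no pole. -/
lemma regularAway_inf_ordGE (hX : IsRegularProjectiveCurve p) {y : X} (hy : y ≠ genericPoint X) :
    regularAway hX y ⊓ ordGE hX hy 1 = ⊥ := by
  rw [eq_bot_iff]
  rintro a ⟨h1, h2⟩
  by_contra ha
  have ha' : a ≠ 0 := ha
  have h3 : 1 ≤ ordRat y a := h2.resolve_left ha'
  have h4 := ord_eq_zero_of_forall_nonneg hX (.mk a ha') (fun z hz => by
    by_cases hzy : z = y
    · subst hzy; exact zero_le_one.trans h3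
    · exact ((mem_regularAway hX).mp h1 z hz hzy).resolve_left ha') y
  change ordRat y a = 0 at h4
  omega

/-- Functions with prescribed zeros and no poles except at `y`. -/
lemma exists_prescribed_zeros (hX : IsRegularProjectiveCurve p) (hPic : PicRankOne X) {x y : X}
    (hy : y ≠ genericPoint X) (T : Finset X) (hT : ∀ z ∈ T, z ≠ genericPoint X ∧ z ≠ x ∧ z ≠ y)
    (m : X → ℕ) (hxy : x ≠ y) :
    ∃ θ : RatUnits X, (∀ z ∈ T, (m z : ℤ) ≤ Scheme.ord θ.val z) ∧
      (∀ z, z ≠ y → 0 ≤ Scheme.ord θ.val z) ∧ Scheme.ord θ.val x = 0 := by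
  classical
  induction T using Finset.induction_on with
  | empty => exact ⟨1, by simp, fun z _ => by rw [map_one, ord_one], by rw [map_one, ord_one]⟩
  | insert w T hw ih =>
    obtain ⟨θ, h1, h2, h3⟩ := ih fun z hz => hT z (Finset.mem_insert_of_mem hz)
    obtain ⟨hwη, hwx, hwy⟩ := hT w (Finset.mem_insert_self w T)
    -- Rank one provides a function with only zero `w` and only pole `y`. Its power `m w` creates
    -- the required zero and changes no other order away from `y`.
    obtain ⟨φ, a, b, ha, -, hφw, -, hφz⟩ := exists_ord_of_picRankOne hX hPic hwη hy hwy
    have hpow (z : X) : Scheme.ord (θ * φ ^ m w).val z =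
        Scheme.ord θ.val z + m w * Scheme.ord φ.val z := by
      rw [map_mul, map_pow, Scheme.ord_mul θ.val_ne_zero (pow_ne_zero _ φ.val_ne_zero),
        ord_pow _ φ.val_ne_zero]
    have hnn (z : X) (hz : z ≠ y) : 0 ≤ (m w : ℤ) * Scheme.ord φ.val z := by
      by_cases hzw : z = w
      · subst hzw; rw [hφw]; positivity
      · rw [hφz z hzw hz, mul_zero]
    refine ⟨θ * φ ^ m w, fun z hz => ?_, fun z hz => ?_, ?_⟩
    · rw [hpow]
      rcases Finset.mem_insert.mp hz with rfl | hz'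
      · have := h2 z hwy
        rw [hφw]
        nlinarith
      · exact (h1 z hz').trans (le_add_of_nonneg_right
          (hnn z (hT z (Finset.mem_insert_of_mem hz')).2.2))
    · rw [hpow]
      exact add_nonneg (h2 z hz) (hnn z hz)
    · rw [hpow, h3, hφz x hwx.symm hxy, mul_zero, add_zero]

/-- A finite dimensional space of functions can be multiplied into the functions which are regular
away from `y`, by a function which is invertible at `x`. -/
lemma exists_mul_mem_regularAway (hX : IsRegularProjectiveCurve p) (hPic : PicRankOne X) {x y : X}
    (hx : x ≠ genericPoint X) (hy : y ≠ genericPoint X) (hxy : x ≠ y) (W : Submodule K (RatField p))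
    [hW : Module.Finite K W] (hWx : W ≤ ordGE hX hx 0) :
    ∃ θ : RatField p, θ ≠ 0 ∧ ordRat x θ = 0 ∧
      W.map (LinearMap.mulLeft K θ) ≤ regularAway hX y := by
  classical
  obtain ⟨S, rfl⟩ := Module.Finite.iff_fg.mp hW
  have hfin : (⋃ w ∈ S, {z | ordRat z w ≠ 0}).Finite := by
    refine S.finite_toSet.biUnion fun w _ => ?_
    by_cases hw : w = 0
    · subst hw
      convert Set.finite_empty
      exact Set.eq_empty_of_forall_notMem fun z hz => hz (congrFun (Scheme.ord_zero (X := X)) z)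
    · exact finite_ord_ne_zero hX (.mk w hw)
  -- The sum of the absolute orders of the generators dominates every pole order at `z`. No zero is
  -- requested at `x`, where the generators are already regular.
  obtain ⟨θ, h1, h2, h3⟩ := exists_prescribed_zeros hX hPic (x := x) hy
    (hfin.toFinset.filter fun z => z ≠ genericPoint X ∧ z ≠ x ∧ z ≠ y)
    (fun z hz => (Finset.mem_filter.mp hz).2) (fun z => ∑ w ∈ S, (ordRat z w).natAbs) hxy
  let t : RatField p := θ.val
  have hθ : t ≠ 0 := θ.val_ne_zero
  refine ⟨t, hθ, h3, ?_⟩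
  rw [Submodule.map_span, Submodule.span_le]
  rintro _ ⟨w, hw, rfl⟩
  refine (mem_regularAway hX).mpr fun z hz hzy => ?_
  change t * w ∈ _
  by_cases hw0 : w = 0
  · rw [hw0, mul_zero]; exact zero_mem _
  have h4 : 0 ≤ ordRat z t := h2 z hzy
  right
  rw [ordRat_mul hθ hw0]
  by_cases hzx : z = x
  · subst hzx
    exact add_nonneg h4 ((hWx (Submodule.subset_span hw)).resolve_left hw0)
  by_cases hzw : ordRat z w = 0
  · rw [hzw, add_zero]; exact h4
  have h5 : ((∑ w ∈ S, (ordRat z w).natAbs : ℕ) : ℤ) ≤ ordRat z t := by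
    refine h1 z (Finset.mem_filter.mpr ⟨hfin.mem_toFinset.mpr ?_, hz, hzx, hzy⟩)
    exact Set.mem_biUnion (Finset.mem_coe.mpr hw) hzw
  have h6 : (ordRat z w).natAbs ≤ ∑ w ∈ S, (ordRat z w).natAbs :=
    Finset.single_le_sum (f := fun w => (ordRat z w).natAbs) (fun _ _ => Nat.zero_le _) hw
  omega

lemma exists_le_ordGE (hX : IsRegularProjectiveCurve p) {y : X}
    (hy : y ≠ genericPoint X) (W : Submodule K (RatField p))
    [hW : Module.Finite K W] : ∃ C : ℕ, W ≤ ordGE hX hy (-C) := by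
  obtain ⟨S, rfl⟩ := Module.Finite.iff_fg.mp hW
  refine ⟨∑ w ∈ S, (ordRat y w).natAbs, Submodule.span_le.mpr fun w hw => Or.inr ?_⟩
  have h6 : (ordRat y w).natAbs ≤ ∑ w ∈ S, (ordRat y w).natAbs :=
    Finset.single_le_sum (f := fun w => (ordRat y w).natAbs) (fun _ _ => Nat.zero_le _) hw
  omega

/-- A function with only zero `x` and only pole `y` has no more zeros than poles. -/
lemma mul_residueDegree_le (hX : IsRegularProjectiveCurve p) (hPic : PicRankOne X) {x y : X}
    (hx : x ≠ genericPoint X) (hy : y ≠ genericPoint X) (hxy : x ≠ y) {φ : RatUnits X} {a b : ℕ}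
    (hφx : Scheme.ord φ.val x = a)
    (hφy : Scheme.ord φ.val y = -b) (hφ : ∀ z, z ≠ x → z ≠ y → Scheme.ord φ.val z = 0) :
    a * residueDegree p x ≤ b * residueDegree p y := by
  have := finite_resField hX hx
  have := finite_resField hX hy
  -- `W` represents the functions regular at `x` modulo those of order at least `a`, of dimension `a
  -- * deg x`. Multiplying by `θ` moves all its poles to `y` without disturbing orders at `x`.
  obtain ⟨W, hWf, hW0, hWa, hWr⟩ := exists_finrank_eq_inf_eq_bot (antitone_ordGE hX hx)
    (exists_leadingCoeff hX hx) a 0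
  obtain ⟨θ, hθ, hθx, hθW⟩ := exists_mul_mem_regularAway hX hPic hx hy hxy W hW0
  have hinj {t : RatField p} (ht : t ≠ 0) : Function.Injective (LinearMap.mulLeft K t) :=
    fun _ _ h => mul_left_cancel₀ ht h
  set W1 := W.map (LinearMap.mulLeft K θ) with hW1
  have hW1r : Module.finrank K W1 = a * residueDegree p x := by
    rw [residueDegree_eq, ← hWr, ← (Submodule.equivMapOfInjective _ (hinj hθ) W).finrank_eq]
  obtain ⟨C, hC⟩ := exists_le_ordGE hX hy W1
  let f : RatField p := φ.val
  have hf : f ≠ 0 := φ.val_ne_zero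
  have hW1x : W1 ≤ ordGE hX hx 0 := by
    rintro _ ⟨w, hw, rfl⟩
    have := (mul_mem_ordGE hX hx hθ).mpr (hW0 hw)
    rwa [hθx, add_zero] at this
  have hW1a : W1 ⊓ ordGE hX hx a = ⊥ := by
    rw [eq_bot_iff]
    rintro _ ⟨⟨w, hw, rfl⟩, h⟩
    have h1 : w ∈ W ⊓ ordGE hX hx (0 + a) := by
      refine ⟨hw, (mul_mem_ordGE hX hx hθ).mp ?_⟩
      rw [hθx, add_zero, zero_add]
      exact h
    rw [hWa] at h1
    rw [(Submodule.mem_bot K).mp h1, map_zero]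
    exact zero_mem _
  -- Multiplication by `φ` sends `N j` into `N (j + 1)`: it only adds a pole of order `b` at `y`.
  let N : ℕ → Submodule K (RatField p) := fun j =>
    regularAway hX y ⊓ ordGE hX hy (-(C + j * b : ℕ))
  have hN : Monotone N := fun i j h => inf_le_inf_left _ (antitone_ordGE hX hy (by
    have := Nat.mul_le_mul_right b h
    omega))
  have hmul (z : X) (hz : z ≠ genericPoint X) (n : ℤ) (c : RatField p) (hc : c ∈ ordGE hX hz n) :
      f * c ∈ ordGE hX hz (n + ordRat z f) := (mul_mem_ordGE hX hz hf).mpr hc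
  have hμN (j : ℕ) : (N j).map (LinearMap.mulLeft K f) ≤ N (j + 1) := by
    rintro _ ⟨c, ⟨h1, h2⟩, rfl⟩
    refine ⟨(mem_regularAway hX).mpr fun z hz hzy => ?_, ?_⟩
    · refine antitone_ordGE hX hz ?_ (hmul z hz 0 c ((mem_regularAway hX).mp h1 z hz hzy))
      rw [zero_add]
      by_cases hzx : z = x
      · subst hzx
        exact (Int.natCast_nonneg a).trans_eq hφx.symm
      · exact (hφ z hzx hzy).ge
    · refine antitone_ordGE hX hy ?_ (hmul y hy _ c h2)
      have : ordRat y f = -b := hφy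
      rw [this]
      push_cast
      linarith
  have hμA : (ordGE hX hx 0).map (LinearMap.mulLeft K f) ≤ ordGE hX hx a := by
    rintro _ ⟨c, hc, rfl⟩
    have := hmul x hx 0 c hc
    have h1 : ordRat x f = a := hφx
    rwa [h1, zero_add] at this
  -- The left side is the dimension of `W1 ⊕ φ W1 ⊕ … ⊕ φ ^ m W1`. This space lies in `N m`, where
  -- the filtration at `y` has `C + m * b + 1` steps before order one, and beyond those no non-zero
  -- function remains.
  have key (m : ℕ) : (m + 1) * (a * residueDegree p x) ≤
      (C + m * b + 1) * residueDegree p y := by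
    obtain ⟨V, hVf, hVN, hVr⟩ := exists_finrank_eq_of_map_le (hinj hf) hN
      (le_inf hθW (by simpa using hC)) hμN hW1x
      (antitone_ordGE hX hx (Int.natCast_nonneg a)) hμA hW1a m
    rw [← hW1r, ← hVr, residueDegree_eq]
    have hVN' := hVN.trans inf_le_left
    refine finrank_le_of_inf_eq_bot (exists_leadingCoeff hX hy) (C + m * b + 1)
      (-(C + m * b : ℕ)) V (hVN'.trans inf_le_right) ?_
    rw [eq_bot_iff, ← regularAway_inf_ordGE hX hy]
    refine inf_le_inf (hVN'.trans inf_le_left) (le_of_eq ?_)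
    congr 1
    push_cast
    ring
  by_contra! h
  -- Comparing growth in `m` gives the inequality. This `m` is large enough that an excess of one
  -- per step beats the constant term `(C + 1) * deg y`.
  obtain ⟨m, hm⟩ : ∃ m, m = (C + 1) * residueDegree p y := ⟨_, rfl⟩
  have h1 := (Nat.mul_le_mul_left (m + 1) (Nat.succ_le_of_lt h)).trans (key m)
  rw [Nat.succ_eq_add_one] at h1
  have h2 := Nat.zero_le (b * residueDegree p y)
  linarith

/-- The degree of the zeros of a function is the degree of its poles. -/
lemma mul_residueDegree_eq (hX : IsRegularProjectiveCurve p) (hPic : PicRankOne X) {x y : X}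
    (hx : x ≠ genericPoint X) (hy : y ≠ genericPoint X) (hxy : x ≠ y) {φ : RatUnits X} {a b : ℕ}
    (hφx : Scheme.ord φ.val x = a)
    (hφy : Scheme.ord φ.val y = -b) (hφ : ∀ z, z ≠ x → z ≠ y → Scheme.ord φ.val z = 0) :
    a * residueDegree p x = b * residueDegree p y := by
  have hinv (z : X) : Scheme.ord (φ⁻¹).val z = -Scheme.ord φ.val z := by
    rw [← ord_inv z φ.val_ne_zero]
    exact congrArg (Scheme.ord · z) (Units.val_inv_eq_inv_val (α := X.functionField) _)
  -- The reverse inequality is the same statement for `φ⁻¹`, which exchanges zero and pole.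
  refine le_antisymm (mul_residueDegree_le hX hPic hx hy hxy hφx hφy hφ) ?_
  refine mul_residueDegree_le hX hPic hy hx hxy.symm (φ := φ⁻¹) ?_ ?_ fun z h1 h2 => ?_
  · rw [hinv, hφy, neg_neg]
  · rw [hinv, hφx]
  · rw [hinv, hφ z h2 h1, neg_zero]

end Degree
end
end TrivialArakelov

namespace TrivialArakelov

noncomputable section

open BerkovichSpace

/-! ## Degrees and linear equivalence -/

section LinearEquivalence

variable {K : Type u} [Field K] {X : Scheme.{u}} [IsIntegral X] [IsLocallyNoetherian X]
  {p : X ⟶ Spec (.of K)}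

lemma ordDivisor_tmul (x : X) (a : ℝ) (E : CartierDivisor X) :
    ordDivisor x (a ⊗ₜ E) = a * ordCartier x E :=
  LinearMap.liftBaseChange_tmul _ _ _ _

lemma finite_ordDivisor_ne_zero (hX : IsRegularProjectiveCurve p) (D : RealDivisor X) :
    {x | ordDivisor x D ≠ 0}.Finite := by
  induction D using TensorProduct.induction_on with
  | zero => simp
  | tmul a E =>
    refine (finite_ordCartier_ne_zero hX E).subset fun x hx h => hx ?_
    rw [ordDivisor_tmul, h, Int.cast_zero, mul_zero]
  | add D E hD hE =>
    refine (hD.union hE).subset fun x hx => ?_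
    by_contra h
    simp only [Set.mem_union, Set.mem_ofPred_eq, not_or, not_not] at h
    exact hx (by rw [map_add, h.1, h.2, add_zero])

lemma degree_add (hX : IsRegularProjectiveCurve p) (D E : RealDivisor X) :
    degree p (D + E) = degree p D + degree p E := by
  have hfin (D : RealDivisor X) :
      (Function.support fun x => ordDivisor x D * (residueDegree p x : ℝ)).Finite :=
    (finite_ordDivisor_ne_zero hX D).subset fun x hx => left_ne_zero_of_mul hx
  rw [degree, degree, degree, ← finsum_add_distrib (hfin D) (hfin E)]
  simp only [map_add, add_mul]

omit [IsLocallyNoetherian X] in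
lemma degree_smul [IsLocallyNoetherian X] (a : ℝ) (D : RealDivisor X) :
    degree p (a • D) = a * degree p D := by
  rw [degree, degree, ← smul_eq_mul, smul_finsum]
  simp only [map_smul, smul_eq_mul, mul_assoc]

lemma degree_pointDivisor (hX : IsRegularProjectiveCurve p) {x : X} (hx : x ≠ genericPoint X) :
    degree p (1 ⊗ₜ pointDivisor hX hx) = residueDegree p x := by
  classical
  rw [degree, finsum_eq_single _ x]
  · rw [ordDivisor_tmul, ordCartier_pointDivisor, if_pos rfl]; simp
  · intro y hy
    rw [ordDivisor_tmul, ordCartier_pointDivisor, if_neg hy]; simp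

/-- Two closed points are proportional to each other up to linear equivalence. -/
lemma exists_pointDivisor_eq (hX : IsRegularProjectiveCurve p) (hPic : PicRankOne X) {x y : X}
    (hx : x ≠ genericPoint X) (hy : y ≠ genericPoint X) :
    ∃ s : RealRat X, (1 : ℝ) ⊗ₜ[ℤ] pointDivisor hX hx =
      ((residueDegree p x : ℝ) / residueDegree p y) • ((1 : ℝ) ⊗ₜ[ℤ] pointDivisor hX hy) +
        principalDivisor X s := by
  classical
  have hdy : (residueDegree p y : ℝ) ≠ 0 := by exact_mod_cast (residueDegree_pos hX hy).ne'
  by_cases hxy : x = y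
  · subst hxy
    exact ⟨0, by rw [div_self hdy, one_smul, map_zero, add_zero]⟩
  obtain ⟨φ, a, b, ha, hb, hφx, hφy, hφ⟩ := exists_ord_of_picRankOne hX hPic hx hy hxy
  lift a to ℕ using ha.le
  lift b to ℕ using hb.le
  have hab := mul_residueDegree_eq hX hPic hx hy hxy hφx hφy hφ
  have e : (a : ℤ) • pointDivisor hX hx =
      (b : ℤ) • pointDivisor hX hy + principalInt X (Additive.ofMul φ) := by
    refine cartierDivisor_ext hX fun z => ?_
    rw [map_add, map_zsmul, map_zsmul, ordCartier_pointDivisor, ordCartier_pointDivisor,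
      ordCartier_principalInt]
    by_cases h1 : z = x
    · subst h1
      rw [hφx]; simp [hxy]
    by_cases h2 : z = y
    · subst h2
      rw [hφy]; simp [h1]
    · rw [hφ z h1 h2]; simp [h1, h2]
  have ha0 : (a : ℝ) ≠ 0 := by exact_mod_cast ha.ne'
  -- Equality of the degrees of zeros and poles turns the coefficient `b / a` into the ratio of
  -- residue degrees.
  have hr : (residueDegree p x : ℝ) / residueDegree p y = (a : ℝ)⁻¹ * b := by
    have hab' : (a : ℝ) * residueDegree p x = b * residueDegree p y := by exact_mod_cast hab
    field_simp
    linarith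
  refine ⟨(a : ℝ)⁻¹ • (1 ⊗ₜ Additive.ofMul φ), ?_⟩
  have e2 : (a : ℝ) • ((1 : ℝ) ⊗ₜ[ℤ] pointDivisor hX hx) =
      (b : ℝ) • ((1 : ℝ) ⊗ₜ[ℤ] pointDivisor hX hy) +
        principalDivisor X (1 ⊗ₜ Additive.ofMul φ) := by
    have e3 : principalDivisor X (1 ⊗ₜ Additive.ofMul φ) =
      (1 : ℝ) ⊗ₜ[ℤ] principalInt X (Additive.ofMul φ) := rfl
    have e4 (n : ℕ) (E : CartierDivisor X) :
        (n : ℝ) • ((1 : ℝ) ⊗ₜ[ℤ] E) = (1 : ℝ) ⊗ₜ[ℤ] ((n : ℤ) • E) := by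
      rw [TensorProduct.tmul_smul, ← Int.cast_smul_eq_zsmul ℝ, Int.cast_natCast]
    rw [e3, e4, e4, e, TensorProduct.tmul_add]
  rw [hr, mul_smul, map_smul, ← smul_add, ← e2, inv_smul_smul₀ ha0]

/-- Up to linear equivalence, every real divisor is a multiple of a given closed point. -/
lemma exists_eq_smul_pointDivisor (hX : IsRegularProjectiveCurve p) (hPic : PicRankOne X) {y : X}
    (hy : y ≠ genericPoint X) (D : RealDivisor X) :
    ∃ s : RealRat X, D =
      (degree p D / residueDegree p y) • ((1 : ℝ) ⊗ₜ[ℤ] pointDivisor hX hy) +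
        principalDivisor X s := by
  -- The property is linear in `D`, so it suffices to treat closed points, which generate.
  let P : RealDivisor X → Prop := fun D => ∃ s : RealRat X, D =
      (degree p D / residueDegree p y) • ((1 : ℝ) ⊗ₜ[ℤ] pointDivisor hX hy) +
        principalDivisor X s
  have hsmul (a : ℝ) {D : RealDivisor X} (hD : P D) : P (a • D) := by
    obtain ⟨s, hs⟩ := hD
    refine ⟨a • s, ?_⟩
    rw [degree_smul, mul_div_assoc, mul_smul, map_smul, ← smul_add, ← hs]
  have hadd {D E : RealDivisor X} (hD : P D) (hE : P E) : P (D + E) := by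
    obtain ⟨s, hs⟩ := hD
    obtain ⟨t, ht⟩ := hE
    refine ⟨s + t, ?_⟩
    rw [degree_add hX, add_div, add_smul, map_add, add_add_add_comm, ← hs, ← ht]
  have hzero : P 0 := by simpa using hsmul 0 (D := 1 ⊗ₜ pointDivisor hX hy) (by
    obtain ⟨s, hs⟩ := exists_pointDivisor_eq hX hPic hy hy
    exact ⟨s, by rwa [degree_pointDivisor]⟩)
  have hone (E : CartierDivisor X) : P (1 ⊗ₜ E) := by
    induction cartierDivisor_mem_closure hX E using AddSubgroup.closure_induction with
    | mem E h =>
      obtain ⟨x, hx, rfl⟩ := h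
      obtain ⟨s, hs⟩ := exists_pointDivisor_eq hX hPic hx hy
      exact ⟨s, by rwa [degree_pointDivisor]⟩
    | zero => rw [TensorProduct.tmul_zero]; exact hzero
    | add E F _ _ hE hF => rw [TensorProduct.tmul_add]; exact hadd hE hF
    | neg E _ hE =>
      rw [TensorProduct.tmul_neg, ← neg_one_smul ℝ]
      exact hsmul _ hE
  change P D
  induction D using TensorProduct.induction_on with
  | zero => exact hzero
  | tmul a E =>
    have : a ⊗ₜ[ℤ] E = a • ((1 : ℝ) ⊗ₜ[ℤ] E) := by
      rw [TensorProduct.smul_tmul', smul_eq_mul, mul_one]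
    rw [this]
    exact hsmul a (hone E)
  | add D E hD hE => exact hadd hD hE

end LinearEquivalence

/-! ## Effectivity of Green functions -/

section Effectivity

variable {K : Type u} [Field K] {X : Scheme.{u}} [IsIntegral X] {p : X ⟶ Spec (.of K)}

lemma continuousOn_absRat {φ : X.functionField} {U : X.Opens} {s : Γ(X, U)}
    (h : ∀ x (hx : x ∈ U), algebraMap (X.presheaf.stalk x) X.functionField
      (X.presheaf.germ U x hx s) = φ) :
    ContinuousOn (fun ξ : BerkovichSpace p => absRat φ ξ) (zariskiOpen p U) := by
  rw [continuousOn_iff']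
  intro V hV
  refine ⟨_, isOpen_absSection U s hV, ?_⟩
  ext ξ
  constructor
  · rintro ⟨h2, h3⟩
    exact ⟨⟨h3, by rw [← absRat_section h ξ h3]; exact h2⟩, h3⟩
  · rintro ⟨⟨h2, h3⟩, h4⟩
    refine ⟨?_, h4⟩
    change absRat φ ξ ∈ V
    rw [absRat_section h ξ h4]; exact h3

lemma absRat_nonneg (φ : X.functionField) (ξ : BerkovichSpace p) : 0 ≤ absRat φ ξ := by
  unfold absRat
  split_ifs
  · exact ξ.abv.nonneg _
  · exact le_rfl

/-- An effective Cartier divisor is locally defined by regular functions. -/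
lemma EffectiveInt.exists_section {E : CartierDivisor X} (hE : EffectiveInt E) (x : X) :
    ∃ (U : X.Opens) (s : Γ(X, U)) (φ : RatUnits X), x ∈ U ∧
      (∀ y ∈ U, E.1 y = toGerm X y (Additive.ofMul φ)) ∧
      ∀ y (hy : y ∈ U), algebraMap (X.presheaf.stalk y) X.functionField
        (X.presheaf.germ U y hy s) = φ.val := by
  obtain ⟨a, φ, ha, hφ⟩ := hE x
  obtain ⟨U, hU, ψ, hψ⟩ := E.2 x
  obtain ⟨u, hu⟩ := mem_localUnits.mp
    ((QuotientGroup.eq (s := localUnits X x) (a := φ) (b := ψ.toMul)).mp (hφ.symm.trans (hψ x hU)))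
  have hau : algebraMap (X.presheaf.stalk x) X.functionField (a * u) = ψ.toMul.val := by
    rw [map_mul, ha, hu, ← map_mul, mul_inv_cancel_left]
  obtain ⟨V, hV, s, hs⟩ := X.presheaf.exists_germ_eq (a * u.1)
  refine ⟨U ⊓ V, X.presheaf.map (homOfLE inf_le_right).op s, ψ.toMul, ⟨hU, hV⟩,
    fun y hy => hψ y hy.1, fun y hy => ?_⟩
  have hη : genericPoint X ∈ V := mem_genericPoint ⟨x, hV⟩
  rw [TopCat.Presheaf.germ_res_apply, algebraMap_stalk_eq y V hy.2 hη,
    ← algebraMap_stalk_eq x V hV hη, hs, hau]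

/-- A local equation is regular at the center, where `v` is bounded by one. -/
lemma EffectiveInt.germLog_nonpos {E : CartierDivisor X} (hE : EffectiveInt E) (v : GenericAbs p)
    {x : X} (h : v.IsCenter x) : v.germLog x h (E.1 x) ≤ 0 := by
  obtain ⟨a, φ, ha, hφ⟩ := hE x
  rw [hφ, GenericAbs.germLog_toGerm]
  exact Real.log_nonpos (v.abv.nonneg _) (h _ ⟨a, ha⟩)

/-- A Green function which at every center is given by the logarithm of local equations of a
multiple of an effective divisor is non-negative. -/
lemma exists_effective_extension [IsLocallyNoetherian X] (hX : IsRegularProjectiveCurve p)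
    {Q : CartierDivisor X} (hQ : EffectiveInt Q) {c : ℝ} (hc : 0 ≤ c) {g : GenericFunction p}
    (hg : IsGreenFunction (c ⊗ₜ Q) g)
    (h : ∀ (v : GenericAbs p) (x : X) (hx : v.IsCenter x),
      v.eval g + v.divLog x hx (c ⊗ₜ Q) = 0) :
    ∃ E : BerkovichSpace p → ℝ, Continuous E ∧ (∀ ξ, 0 ≤ E ξ) ∧
      g.1.map (fun t => Real.exp (-t)) = (E : Germ (generic p) ℝ) ∧ ∀ ξ, E ξ ≤ 1 := by
  have hloc (z : X) : ∃ (U : X.Opens) (E : BerkovichSpace p → ℝ), z ∈ U ∧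
      ContinuousOn E (zariskiOpen p U) ∧ (∀ ξ, 0 ≤ E ξ) ∧
      ∀ v : GenericAbs p, E v.toBerkovich = Real.exp (-v.eval g) := by
    obtain ⟨U, s, φ, hz, hφ, hs⟩ := hQ.exists_section z
    obtain ⟨k, hk, e⟩ := hg U (c ⊗ₜ Additive.ofMul φ) ⟨z, hz⟩ fun y hy => by
      simp [realGerm, hφ y hy]
    -- With `k` the continuous extension of `g + c log |φ|`, this product equals `exp (-g)` above
    -- the generic point. It remains continuous at the zeros of `φ` because `c ≥ 0`.
    refine ⟨U, fun ξ => Real.exp (-k ξ) * absRat φ.val ξ ^ c, hz, ?_, fun ξ => ?_, fun v => ?_⟩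
    · exact hk.neg.rexp.mul ((continuousOn_absRat hs).rpow_const fun _ _ => Or.inr hc)
    · exact mul_nonneg (Real.exp_pos _).le (Real.rpow_nonneg (absRat_nonneg _ _) _)
    · have h1 := v.eval_eq e
      rw [map_add, v.eval_logAbs, v.log_tmul] at h1
      simp only [v.absRat_toBerkovich]
      rw [Real.rpow_def_of_pos (v.abv_pos φ), ← Real.exp_add, ← h1]
      congr 1
      ring
  choose U E hU hE h0 hEv using hloc
  -- The local extensions glue, since they agree with `exp (-g)` on the dense set of points above
  -- the generic point.
  have hagree (z w : X) (ξ : BerkovichSpace p) (h1 : ξ.pt ∈ U z) (h2 : ξ.pt ∈ U w) :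
      E z ξ = E w ξ :=
    eqOn_of_eqOn_generic hX (U := U z ⊓ U w) ((hE z).mono fun _ h => h.1)
      ((hE w).mono fun _ h => h.2) (fun v => (hEv z v).trans (hEv w v).symm) ⟨h1, h2⟩
  have hcont : Continuous fun ξ : BerkovichSpace p => E ξ.pt ξ := by
    rw [continuous_iff_continuousAt]
    intro ξ
    have hn := (isOpen_zariskiOpen p (U ξ.pt)).mem_nhds (hU ξ.pt)
    refine ((hE ξ.pt).continuousAt hn).congr ?_
    filter_upwards [hn] with ζ hζ
    exact hagree _ _ ζ hζ (hU ζ.pt)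
  refine ⟨fun ξ => E ξ.pt ξ, hcont, fun ξ => h0 _ _, ?_, ?_⟩
  · obtain ⟨V, hV, k, hk, e⟩ := g.2
    rw [e]
    refine Germ.coe_eq.mpr ?_
    filter_upwards [zariskiOpen_mem_generic p hV] with ξ hξ
    refine eqOn_of_eqOn_generic hX hk.neg.rexp hcont.continuousOn (fun v => ?_) hξ
    rw [hEv, v.eval_eq e]
    rfl
  -- Writing `E ≤ 1` as `max E 1 = 1` lets the density argument for equalities apply. Above the
  -- generic point a center exists, and there `g = -c log |Q| ≥ 0`.
  · have hmax := eqOn_of_eqOn_generic hX (U := ⊤)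
      (h := fun ξ : BerkovichSpace p => max (E ξ.pt ξ) 1) (k := fun _ => 1)
      (hcont.max continuous_const).continuousOn continuousOn_const fun v => by
        refine max_eq_right ?_
        obtain ⟨x, hx⟩ := v.exists_isCenter hX
        have h1 := h v x hx
        rw [v.divLog_tmul] at h1
        have h2 := mul_nonpos_of_nonneg_of_nonpos hc (hQ.germLog_nonpos v hx)
        rw [hEv, Real.exp_le_one_iff]
        linarith
    intro ξ
    exact max_eq_right_iff.mp (hmax (x := ξ) trivial)

lemma effective_tmul {Q : CartierDivisor X} (hQ : EffectiveInt Q) {c : ℝ} (hc : 0 ≤ c) :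
    Effective (c ⊗ₜ[ℤ] Q : RealDivisor X) := by
  rcases hc.eq_or_lt with rfl | hc
  -- Coefficients must be strictly positive, so `c = 0` calls for the empty sum.
  · exact ⟨0, Fin.elim0, Fin.elim0, fun i => i.elim0, fun i => i.elim0, by simp⟩
  · exact ⟨1, fun _ => c, fun _ => Q, fun _ => hc, fun _ => hQ, by simp⟩

/-- If `φ` is a local equation of `D + (s)`, then `φ - s` (written additively) is one of `D`, and
the two functions to be extended coincide. -/
lemma IsGreenFunction.sub_logAbs {D : RealDivisor X} {g : GenericFunction p}
    (hg : IsGreenFunction D g) (s : RealRat X) :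
    IsGreenFunction (D + principalDivisor X s) (g - logAbs p s) := by
  intro U φ hU hφ
  have := hg U (φ - s) hU fun x hx => by
    rw [map_sub, ← hφ x hx, map_add, GenericAbs.realGerm_principalDivisor, add_sub_cancel_right]
  rwa [map_sub, add_sub, add_sub_right_comm] at this

end Effectivity
end
end TrivialArakelov

/-! ### Conclusion: vanishing defect and an effective representative -/

theorem mainTheorem7 {K : Type u} [Field K] {X : Scheme.{u}} [IsIntegral X]
    [IsLocallyNoetherian X] (p : X ⟶ Spec (.of K))
    (hX : TrivialArakelov.IsRegularProjectiveCurve p)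
    (hPic : TrivialArakelov.PicRankOne X)
    (f : X ⟶ X) [Surjective f] (hf : f ≫ p = p)
    (D : TrivialArakelov.RealDivisor X) (d : ℝ) (hd : 1 < d) (φ : TrivialArakelov.RealRat X)
    (hD : TrivialArakelov.divisorPullback f D = d • D + TrivialArakelov.principalDivisor X φ)
    (hdeg : 0 ≤ TrivialArakelov.degree p D)
    (A : TrivialArakelov.AdelicDivisor p)
    (hA : A.IsCanonicalCompactification D f hf d φ) :
    A.DirichletProperty := by
  open TrivialArakelov in
  obtain ⟨rfl, hg⟩ := hA
  obtain ⟨C, hC⟩ := exists_bound_eval_add_divLog hX A.isGreen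
  have hz := GenericAbs.eval_add_divLog_eq_zero f hf hd hD hg hC
  obtain ⟨y, hy⟩ := exists_ne_genericPoint hX
  obtain ⟨s, hs⟩ := exists_eq_smul_pointDivisor hX hPic hy A.divisor
  have hc : 0 ≤ degree p A.divisor / residueDegree p y := div_nonneg hdeg (Nat.cast_nonneg _)
  -- The function witnessing the Dirichlet property is `-s`, as `A.divisor` is the multiple of `y`
  -- plus `(s)`.
  have e : A.divisor + principalDivisor X (-s) =
      (degree p A.divisor / residueDegree p y) ⊗ₜ[ℤ] pointDivisor hX hy := by
    rw [map_neg, ← sub_eq_add_neg, sub_eq_iff_eq_add]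
    refine hs.trans ?_
    rw [TensorProduct.smul_tmul', smul_eq_mul, mul_one]
  have hB := A.isGreen.sub_logAbs (-s)
  refine ⟨⟨_, _, hB⟩, ⟨-s, rfl, rfl⟩, ?_, ?_⟩
  · change Effective (A.divisor + principalDivisor X (-s))
    rw [e]
    exact effective_tmul (effectiveInt_pointDivisor hX hy) hc
  · refine exists_effective_extension hX (effectiveInt_pointDivisor hX hy) hc (by rwa [← e]) ?_
    intro v x hx
    -- The defect does not change under linear equivalence: the two contributions of `-s` cancel.
    rw [← e, map_add, map_sub, v.eval_logAbs, v.divLog_principalDivisor]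
    linarith [hz v x hx]
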